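/- **The space.** Set $t_0=0$, $t_1=1$, $t_2=1+\pi$ and, for $k\ge 1$, $t_{2k}=-\pi+(1+2\pi)2^{k-1}$, $t_{2k+1}=-\pi+(2+2\pi)2^{k-1}$. Let $\gamma:[0,\infty)\to\mathbb C$ be the continuous, injective curve, parametrized by arc length with $\gamma(0)=0$, such that $\gamma([t_0,t_1])=[0,1]$; for $k\ge1$, $\gamma([t_{2k},t_{2k+1}])$ is the real segment $[2^{k-1},2^k]$ if $k$ is even and $[-2^k,-2^{k-1}]$ if $k$ is odd; and for $k\ge 0$, $\gamma([t_{2k+1},t_{2k+2}])$ is the half-circle of centre $0$ and radius $2^k$ lying in $\{\Im z\ge0\}$ if $k$ is even and in $\{\Im z\le0\}$ if $k$ is odd. Let $X_T=\gamma([0,\infty))$ (the curve of Tessera), with the Euclidean distance $\rho$ and the Hausdorff length $\mu$ (one-dimensional Hausdorff measure). For $z\in X_T$ and $r>0$ let $B(z,r)=\{x\in X_T: |x-z|<r\}$; complements are taken in $X_T$. **Proposition.** 1. $X_T$ is Ahlfors–David regular of dimension $1$: there is $0<C<\infty$ with $r/C\le\mu(B(z,r))\le Cr$ for all $z\in X_T$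 and $r>0$. In particular $(X_T,\rho,\mu)$ is a space of homogeneous type: there is $C<\infty$ with $0<\mu(B(z,2r))\le C\mu(B(z,r))<\infty$ for all $z\in X_T$ and $r>0$. 2. $X_T$ does not satisfy the annular decay property (AD); here (AD) is the property that there exist $\eta>0$, $C<\infty$ such that for all $z\in X_T$ and $0<s<r$, $$\mu\big(B(z,r)\setminus B(z,r-s)\big)\le C\,(s/r)^{\eta}\,\mu(B(z,r)).$$ Nor does it satisfy the relative annular decay property (RAD); here (RAD) is the property that there exist $\eta>0$, $C<\infty$ such that for all $z,w\in X_T$, $0<s<r$ and $0<R\le2r$, $$\mu\big((B(z,r)\setminus B(z,r-s))\cap B(w,R)\big)\le C\,(s/R)^{\eta}\,\mu(B(w,R)).$$ 3. $X_T$ does not satisfy the homogeneous balls property (HB); here (HB) is the property that there is $C<\infty$ such that for every ball $B$, all $x\in B$, $y\in B^c$ and $r>0$, $$\mu(B(x,2r)\cap B)\le C\mu(B(x,r)\cap B),\qquad \mu(B(y,2r)\cap B^c)\le C\mu(B(y,r)\cap B^c).$$ Nor does it satisfy the monotone geodesic property (M); here (M) is the property that there is $0<C<\infty$ such that for all $u>0$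 and $x,y\in X_T$ with $\rho(x,y)\ge u$ there is $z\in X_T$ with $\rho(z,y)\le Cu$ and $\rho(z,x)\le\rho(y,x)-u$. 4. $X_T$ satisfies the relative layer decay property (RLD): there exist $\eta>0$, $C<\infty$ such that for every ball $B=B(z,r)$, every ball $B(w,R)$ with $R\le2r$ and every $\varepsilon>0$, $$\mu\big(B_\varepsilon\cap B(w,R)\big)\le C\,(\varepsilon/R)^{\eta}\,\mu(B(w,R)),$$ where $B_\varepsilon=\{x\in B:\rho(x,B^c)\le\varepsilon\}\cup\{y\in B^c:\rho(y,B)\le\varepsilon\}$. 5. $X_T$ satisfies the Hardy property (HP): for every $1<\nu<\infty$, with $\nu'=\nu/(\nu-1)$, there is $C<\infty$ such that for every ball $B=B(z,r)$, with $2B=B(z,2r)$, every $f\in L^{\nu}(\mu)$ supported on $B$ and every $g\in L^{\nu'}(\mu)$ supported on $2B\setminus B$, $$\int_B\int_{2B\setminus B}\frac{|f(y)g(x)|}{\lambda(x,y)}\,d\mu(x)\,d\mu(y)\le C\,\|f\|_{\nu}\,\|g\|_{\nu'},\qquad \lambda(x,y)=\mu\big(B(x,\rho(x,y))\big).$$ 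-/

import Mathlib

open MeasureTheory Set Metric
open scoped NNReal ENNReal

/-! ### Metric measure spaces -/

section Properties

variable {X : Type*} [MetricSpace X] [MeasurableSpace X]

/-- `(X, ρ, μ)` is a space of homogeneous type: there is a finite constant `C` with
`0 < μ (B(x, 2r)) ≤ C μ (B(x, r)) < ∞` for all `x` and all `r > 0`. -/
def IsHomogeneousType (μ : Measure X) : Prop :=
  ∃ C : ℝ≥0, ∀ (x : X) (r : ℝ), 0 < r →
    0 < μ (ball x (2 * r)) ∧ μ (ball x (2 * r)) ≤ C * μ (ball x r) ∧ μ (ball x r) < ∞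

/-- Ahlfors-David regularity of dimension `1` (of an unbounded space):
`r / C ≤ μ (B(x, r)) ≤ C r` for all points `x` of the space and all `r > 0`. -/
def IsAhlforsDavidRegularOne (μ : Measure X) : Prop :=
  ∃ C : ℝ, 0 < C ∧ ∀ (x : X) (r : ℝ), 0 < r →
    ENNReal.ofReal (r / C) ≤ μ (ball x r) ∧ μ (ball x r) ≤ ENNReal.ofReal (C * r)

/-- The annulus `C_{r, s}(z) = B(z, r) \ B(z, s)`. -/
def annulus (z : X) (r s : ℝ) : Set X := ball z r \ ball z s

/-- The annular decay property (AD). -/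
def AnnularDecay (μ : Measure X) : Prop :=
  ∃ η : ℝ, 0 < η ∧ ∃ C : ℝ≥0, ∀ (z : X) (r s : ℝ), 0 < r → 0 < s → s < r →
    μ (annulus z r (r - s)) ≤ C * ENNReal.ofReal ((s / r) ^ η) * μ (ball z r)

/-- The relative annular decay property (RAD). -/
def RelativeAnnularDecay (μ : Measure X) : Prop :=
  ∃ η : ℝ, 0 < η ∧ ∃ C : ℝ≥0, ∀ (z : X) (r s : ℝ), 0 < r → 0 < s → s < r →
    ∀ (w : X) (R : ℝ), 0 < R → R ≤ 2 * r →
      μ (annulus z r (r - s) ∩ ball w R) ≤ C * ENNReal.ofReal ((s / R) ^ η) * μ (ball w R)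

/-- The union `B_ε` of the inner layer `{x ∈ B | ρ(x, Bᶜ) ≤ ε}` and of the outer layer
`{y ∈ Bᶜ | ρ(y, B) ≤ ε}` of a set `B`; the distance to the empty set is `∞`. -/
def layer (B : Set X) (ε : ℝ) : Set X :=
  {x | x ∈ B ∧ infEDist x Bᶜ ≤ ENNReal.ofReal ε} ∪ {y | y ∈ Bᶜ ∧ infEDist y B ≤ ENNReal.ofReal ε}

/-- The relative layer decay property (RLD). -/
def RelativeLayerDecay (μ : Measure X) : Prop :=
  ∃ η : ℝ, 0 < η ∧ ∃ C : ℝ≥0, ∀ (z : X) (r : ℝ), 0 < r →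
    ∀ (w : X) (R : ℝ), 0 < R → R ≤ 2 * r → ∀ ε : ℝ, 0 < ε →
      μ (layer (ball z r) ε ∩ ball w R) ≤ C * ENNReal.ofReal ((ε / R) ^ η) * μ (ball w R)

/-- The homogeneous balls property (HB): all balls and their complements are doubling,
with a uniform constant. -/
def HomogeneousBalls (μ : Measure X) : Prop :=
  ∃ C : ℝ≥0, ∀ (z : X) (R : ℝ), 0 < R →
    (∀ x ∈ ball z R, ∀ r : ℝ, 0 < r →
      μ (ball x (2 * r) ∩ ball z R) ≤ C * μ (ball x r ∩ ball z R)) ∧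
    (∀ y ∈ (ball z R)ᶜ, ∀ r : ℝ, 0 < r →
      μ (ball y (2 * r) ∩ (ball z R)ᶜ) ≤ C * μ (ball y r ∩ (ball z R)ᶜ))

/-- The Hardy property (HP), with `λ(x, y) = μ (B(x, ρ(x, y)))` and dual exponent
`ν' = ν / (ν - 1)`. -/
def HardyProperty (μ : Measure X) : Prop :=
  ∀ ν : ℝ, 1 < ν → ∃ C : ℝ≥0, ∀ (z : X) (r : ℝ), 0 < r → ∀ f g : X → ℂ,
    MemLp f (ENNReal.ofReal ν) μ → Function.support f ⊆ ball z r →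
    MemLp g (ENNReal.ofReal (ν / (ν - 1))) μ →
    Function.support g ⊆ ball z (2 * r) \ ball z r →
      ∫⁻ y in ball z r, ∫⁻ x in ball z (2 * r) \ ball z r,
          ‖f y * g x‖ₑ / μ (ball x (dist x y)) ∂μ ∂μ
        ≤ C * eLpNorm f (ENNReal.ofReal ν) μ * eLpNorm g (ENNReal.ofReal (ν / (ν - 1))) μ

end Properties

/-- The monotone geodesic property (M) of a metric space. -/
def MonotoneGeodesic (X : Type*) [MetricSpace X] : Prop :=
  ∃ C : ℝ, 0 < C ∧ ∀ u : ℝ, 0 < u → ∀ x y : X, u ≤ dist x y →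
    ∃ z : X, dist z y ≤ C * u ∧ dist z x ≤ dist y x - u

/-! ### The curve of Tessera

Stage `k` of the curve consists of a radial segment on the real axis, from modulus
`tesseraInner k` to modulus `2 ^ k`, followed by a half-circle of centre `0` and radius `2 ^ k`,
travelled counterclockwise. It lasts from `tesseraStart k` to `tesseraStart (k + 1)`. -/

/-- The modulus at which stage `k` begins: `0` for `k = 0`, and `2 ^ (k - 1)` for `k ≥ 1`. -/
noncomputable def tesseraInner : ℕ → ℝ
  | 0 => 0
  | k + 1 => 2 ^ k

/-- The time `t_{2k}` at which stage `k` begins. -/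
noncomputable def tesseraStart : ℕ → ℝ
  | 0 => 0
  | k + 1 => tesseraStart k + (2 ^ k - tesseraInner k) + Real.pi * 2 ^ k

/-- The time `t_{2k+1}` at which the half-circle of stage `k` begins. -/
noncomputable def tesseraMid (k : ℕ) : ℝ := tesseraStart k + (2 ^ k - tesseraInner k)

/-- The stage of the time `t ≥ 0`: the largest `k` with `t_{2k} ≤ t`. -/
noncomputable def tesseraStage (t : ℝ) : ℕ := sSup {k : ℕ | tesseraStart k ≤ t}

open Classical in
/-- The arc length parametrization `γ(t)`, `t ≥ 0`, of the curve of Tessera. -/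
noncomputable def tesseraParam (t : ℝ) : ℂ :=
  let k := tesseraStage t
  if t ≤ tesseraMid k then
    (-1) ^ k * ((tesseraInner k + (t - tesseraStart k) : ℝ) : ℂ)
  else
    (-1) ^ k * 2 ^ k * Complex.exp (((t - tesseraMid k) / 2 ^ k : ℝ) * Complex.I)

/-- The curve of Tessera `X_T = {γ(t) | t ≥ 0}` in the complex plane. As a type it carries the
Euclidean distance of `ℂ`. -/
def tesseraCurve : Set ℂ := tesseraParam '' Ici 0

lemma tesseraInner_le (k : ℕ) : 0 ≤ tesseraInner k ∧ tesseraInner k < 2 ^ k := by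
  cases k with
  | zero => simp [tesseraInner]
  | succ k =>
    have : (0 : ℝ) < 2 ^ k := by positivity
    simp only [tesseraInner, pow_succ]
    constructor <;> linarith

lemma tesseraStart_succ (k : ℕ) :
    tesseraStart (k + 1) = tesseraMid k + Real.pi * 2 ^ k := rfl

/-- The closed form of `t_{2k}` for `k ≥ 1`. -/
lemma tesseraStart_closed (k : ℕ) :
    tesseraStart (k + 1) = -Real.pi + (1 + 2 * Real.pi) * 2 ^ k := by
  induction k with
  | zero => simp [tesseraStart, tesseraInner]; ring
  | succ k ih => rw [tesseraStart, ih, tesseraInner]; ring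

lemma tesseraStart_lt_mid (k : ℕ) : tesseraStart k < tesseraMid k := by
  have := (tesseraInner_le k).2
  unfold tesseraMid; linarith

lemma tesseraMid_lt_start (k : ℕ) : tesseraMid k < tesseraStart (k + 1) := by
  have : 0 < Real.pi * 2 ^ k := by positivity
  rw [tesseraStart_succ]; linarith

lemma tesseraStart_strictMono : StrictMono tesseraStart :=
  strictMono_nat_of_lt_succ fun k => (tesseraStart_lt_mid k).trans (tesseraMid_lt_start k)

lemma nat_le_tesseraStart (k : ℕ) : (k : ℝ) ≤ tesseraStart k := by
  cases k with
  | zero => simp [tesseraStart]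
  | succ k =>
    rw [tesseraStart_closed]
    have h1 : (k : ℝ) + 1 ≤ 2 ^ k := by exact_mod_cast Nat.lt_two_pow_self
    have h3 : (1 : ℝ) ≤ 2 ^ k := one_le_pow₀ (by norm_num)
    push_cast
    nlinarith [Real.pi_pos]

lemma tesseraStage_eq {k : ℕ} {t : ℝ} (h1 : tesseraStart k ≤ t) (h2 : t < tesseraStart (k + 1)) :
    tesseraStage t = k := by
  refine IsGreatest.csSup_eq ⟨h1, fun j hj => ?_⟩
  have : tesseraStart j < tesseraStart (k + 1) := lt_of_le_of_lt hj h2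
  exact Nat.lt_succ_iff.mp (tesseraStart_strictMono.lt_iff_lt.mp this)

lemma exists_tesseraStage {t : ℝ} (ht : 0 ≤ t) :
    ∃ k, tesseraStart k ≤ t ∧ t < tesseraStart (k + 1) := by
  have hex : ∃ n, t < tesseraStart n := by
    obtain ⟨n, hn⟩ := exists_nat_gt t
    exact ⟨n, hn.trans_le (nat_le_tesseraStart n)⟩
  classical
  have h0 : Nat.find hex ≠ 0 := by
    intro h
    have := Nat.find_spec hex
    rw [h] at this
    simp only [tesseraStart] at this
    linarith
  obtain ⟨k, hk⟩ := Nat.exists_eq_succ_of_ne_zero h0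
  refine ⟨k, not_lt.mp (Nat.find_min hex (by omega)), ?_⟩
  have := Nat.find_spec hex
  rwa [hk] at this

/-- On the first part of stage `k`, the curve runs along the real axis at unit speed. -/
lemma tesseraParam_segment {k : ℕ} {t : ℝ} (h1 : tesseraStart k ≤ t) (h2 : t ≤ tesseraMid k) :
    tesseraParam t = (-1) ^ k * ((tesseraInner k + (t - tesseraStart k) : ℝ) : ℂ) := by
  have := tesseraStage_eq h1 (h2.trans_lt (tesseraMid_lt_start k))
  simp only [tesseraParam, this, if_pos h2]

/-- On the second part of stage `k`, the curve runs along a half-circle at unit speed. -/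
lemma tesseraParam_arc {k : ℕ} {t : ℝ} (h1 : tesseraMid k ≤ t) (h2 : t ≤ tesseraStart (k + 1)) :
    tesseraParam t =
      (-1) ^ k * 2 ^ k * Complex.exp (((t - tesseraMid k) / 2 ^ k : ℝ) * Complex.I) := by
  rcases h1.eq_or_lt with h | h
  · subst h
    rw [tesseraParam_segment (tesseraStart_lt_mid k).le le_rfl]
    simp [tesseraMid]
  rcases h2.eq_or_lt with h' | h'
  · subst h'
    rw [tesseraParam_segment le_rfl (tesseraStart_lt_mid _).le, tesseraStart_succ]
    have h3 : (tesseraMid k + Real.pi * 2 ^ k - tesseraMid k) / 2 ^ k = Real.pi := by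
      field_simp; ring
    rw [h3, Complex.exp_pi_mul_I]
    simp [tesseraInner, pow_succ]
  · have := tesseraStage_eq ((tesseraStart_lt_mid k).le.trans h1) h'
    simp only [tesseraParam, this, if_neg (not_le.mpr h)]

/-- `X_T` is the union of the segments `(-1)^k [2^(k-1), 2^k]` (with `[0, 1]` for `k = 0`) and of
the half-circles of centre `0` and radius `2^k`, in the upper half-plane for even `k` and in the
lower half-plane for odd `k`. -/
lemma tesseraCurve_eq : tesseraCurve =
    (⋃ k : ℕ, {z : ℂ | ∃ a ∈ Icc (tesseraInner k) (2 ^ k), z = (-1) ^ k * (a : ℂ)}) ∪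
    (⋃ k : ℕ, {z : ℂ | ‖z‖ = 2 ^ k ∧ 0 ≤ (-1) ^ k * z.im}) := by
  have hneg : ∀ k : ℕ, ((-1 : ℂ) ^ k) = (((-1 : ℝ) ^ k : ℝ) : ℂ) := fun k => by push_cast; rfl
  have hsq : ∀ k : ℕ, ((-1 : ℝ) ^ k) * (-1) ^ k = 1 := fun k => by
    rw [← mul_pow]; norm_num
  ext z
  simp only [mem_union, mem_iUnion, mem_ofPred_eq, tesseraCurve, mem_image, mem_Ici]
  constructor
  · rintro ⟨t, ht, rfl⟩
    obtain ⟨k, h1, h2⟩ := exists_tesseraStage ht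
    rcases le_total t (tesseraMid k) with h | h
    · refine Or.inl ⟨k, _, ⟨?_, ?_⟩, tesseraParam_segment h1 h⟩
      · linarith
      · unfold tesseraMid at h; linarith
    · refine Or.inr ⟨k, ?_⟩
      rw [tesseraParam_arc h h2.le]
      constructor
      · rw [norm_mul, Complex.norm_exp_ofReal_mul_I]; simp
      · have h3 : (-1 : ℂ) ^ k * 2 ^ k = (((-1 : ℝ) ^ k * 2 ^ k : ℝ) : ℂ) := by push_cast; rfl
        rw [h3, Complex.im_ofReal_mul, Complex.exp_ofReal_mul_I_im, ← mul_assoc, ← mul_assoc, hsq,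
          one_mul]
        refine mul_nonneg (by positivity) (Real.sin_nonneg_of_nonneg_of_le_pi ?_ ?_)
        · exact div_nonneg (by linarith) (by positivity)
        · rw [tesseraStart_succ] at h2
          rw [div_le_iff₀ (by positivity)]; linarith
  · rintro (⟨k, a, ⟨ha1, ha2⟩, rfl⟩ | ⟨k, hz, him⟩)
    · refine ⟨tesseraStart k + (a - tesseraInner k), ?_, ?_⟩
      · have := tesseraStart_strictMono.monotone (Nat.zero_le k)
        simp only [tesseraStart] at this
        linarith
      · rw [tesseraParam_segment (k := k) (by linarith) (by unfold tesseraMid; linarith)]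
        congr 2; ring
    · set w : ℂ := (-1) ^ k * z with hw
      have hwn : ‖w‖ = 2 ^ k := by rw [hw, norm_mul, hz]; simp
      have hwi : 0 ≤ w.im := by rw [hw, hneg, Complex.im_ofReal_mul]; exact him
      have harg := Complex.arg_nonneg_iff.mpr hwi
      have harg' := Complex.arg_le_pi w
      have hp : (0 : ℝ) < 2 ^ k := by positivity
      have h0 : 0 ≤ tesseraMid k := by
        have h := tesseraStart_strictMono.monotone (Nat.zero_le k)
        simp only [tesseraStart] at h
        exact h.trans (tesseraStart_lt_mid k).le
      refine ⟨tesseraMid k + 2 ^ k * w.arg, by positivity, ?_⟩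
      rw [tesseraParam_arc (k := k) (by nlinarith) (by rw [tesseraStart_succ]; nlinarith)]
      have h3 : (tesseraMid k + 2 ^ k * w.arg - tesseraMid k) / 2 ^ k = w.arg := by
        field_simp; ring
      have h4 := Complex.norm_mul_exp_arg_mul_I w
      rw [hwn] at h4
      push_cast at h4
      rw [h3, mul_assoc, h4, hw, ← mul_assoc, ← mul_pow]
      norm_num

/-! Stage `k` of the curve, a segment followed by a half-circle, has size comparable to `2 ^ k`.
Everything positive rests on one estimate: the `ε`-layer of a ball has length `O(ε)` in each stage.
A circle meets the real axis in at most two points, and a half-circle in at most two points unless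
they are concentric. A layer point `x` has a nearby `y` across the sphere; either the curve crosses
the sphere between them, close to `x`, or `y` lies on another piece and `x` is close to an end of
its own. In the concentric case the half-circle is wholly on one side of the sphere, so only its
ends are close to the other side. This is why layers decay although annuli do not
(`exists_finset_tesseraSegment`, `exists_finset_tesseraArc`).

A ball of radius `R` meets at most two stages much larger than `R`, and the sizes of the others grow
geometrically. Summing `min (2 ^ k) ε ≤ √(2 ^ k * ε)` over them gives `O(√(ε R))`
(`hausdorffMeasure_le_of_forall_stagePart`). With `ε = R` this is the upper regularity bound, and
for layers it is (RLD) with exponent `1 / 2`. The lower regularity bound is connectedness: the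
distance to the centre takes all values in `[0, r)`.

For (HP), `λ(x, y) ≥ ρ(x, y)` reduces the kernel to `1 / ρ(x, y)`. Schur's test applies with a power
of the distance to the other side of the ball as weight; the test integral is summed over dyadic
distances and dyadic layers (`SqrtLayerDecay.exists_lintegral_le`).

The failures are local. Near `i` the curve lies on the unit circle about the point `0` of the curve,
which defeats (AD) and (M). Near `2` the curve is the end of a half-circle followed by an outward
segment, and a ball centred near `0` that barely contains `2` keeps only a tiny piece of it, which
defeats (HB). -/

/-! ### Chords of the unit circle -/

lemma norm_exp_mul_I_sub (θ φ : ℝ) :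
    ‖Complex.exp (θ * Complex.I) - Complex.exp (φ * Complex.I)‖
      = 2 * |Real.sin ((θ - φ) / 2)| := by
  have h : Complex.exp (θ * Complex.I) - Complex.exp (φ * Complex.I) =
      Complex.exp (φ * Complex.I) * (Complex.exp (Complex.I * ((θ - φ : ℝ) : ℂ)) - 1) := by
    rw [mul_sub, ← Complex.exp_add]
    push_cast
    ring_nf
  rw [h, norm_mul, Complex.norm_exp_ofReal_mul_I, one_mul,
    Complex.norm_exp_I_mul_ofReal_sub_one]
  simp

lemma norm_exp_mul_I_sub_le (θ φ : ℝ) :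
    ‖Complex.exp (θ * Complex.I) - Complex.exp (φ * Complex.I)‖ ≤ |θ - φ| := by
  rw [norm_exp_mul_I_sub]
  have := Real.abs_sin_le_abs (x := (θ - φ) / 2)
  rw [abs_div, abs_two] at this
  linarith

/-- Jordan's inequality `sin x ≥ 2 x / π` on `[0, π / 2]`; the factor `2` comes from `π ≤ 4`. -/
lemma abs_sub_le_norm_exp_mul_I_sub {θ φ : ℝ} (h : |θ - φ| ≤ Real.pi) :
    |θ - φ| ≤ 2 * ‖Complex.exp (θ * Complex.I) - Complex.exp (φ * Complex.I)‖ := by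
  rw [norm_exp_mul_I_sub]
  have h1 : Real.sin (|θ - φ| / 2) ≤ |Real.sin ((θ - φ) / 2)| := by
    rcases abs_cases (θ - φ) with ⟨h', _⟩ | ⟨h', _⟩ <;> rw [h']
    · exact le_abs_self _
    · rw [neg_div, Real.sin_neg]; exact neg_le_abs _
  have h2 := Real.mul_le_sin (x := |θ - φ| / 2) (by positivity) (by linarith)
  have h3 : 1 / 2 ≤ 2 / Real.pi := by
    rw [div_le_div_iff₀ (by norm_num) Real.pi_pos]; linarith [Real.pi_le_four]
  nlinarith [abs_nonneg (θ - φ)]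

/-! ### The pieces of the curve -/

/-- The radial segment of stage `k`. -/
def tesseraSegment (k : ℕ) : Set ℂ := {z | ∃ a ∈ Icc (tesseraInner k) (2 ^ k), z = (-1) ^ k * (a : ℂ)}

/-- The half-circle of stage `k`. -/
def tesseraArc (k : ℕ) : Set ℂ := {z | ‖z‖ = 2 ^ k ∧ 0 ≤ (-1) ^ k * z.im}

lemma tesseraCurve_eq_iUnion : tesseraCurve = ⋃ k, (tesseraSegment k ∪ tesseraArc k) := by
  rw [tesseraCurve_eq, iUnion_union_distrib]; rfl

lemma tesseraSegment_subset (k : ℕ) : tesseraSegment k ⊆ tesseraCurve := by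
  rw [tesseraCurve_eq_iUnion]
  exact fun x hx => mem_iUnion.mpr ⟨k, Or.inl hx⟩

lemma tesseraArc_subset (k : ℕ) : tesseraArc k ⊆ tesseraCurve := by
  rw [tesseraCurve_eq_iUnion]
  exact fun x hx => mem_iUnion.mpr ⟨k, Or.inr hx⟩

lemma neg_one_pow_eq_ofReal (k : ℕ) : ((-1 : ℂ) ^ k) = (((-1 : ℝ) ^ k : ℝ) : ℂ) := by
  push_cast; rfl

lemma neg_one_pow_mul_self {R : Type*} [CommRing R] (k : ℕ) : ((-1 : R) ^ k) * (-1) ^ k = 1 := by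
  rw [← mul_pow]; norm_num

lemma norm_of_mem_tesseraSegment {k : ℕ} {x : ℂ} (hx : x ∈ tesseraSegment k) :
    tesseraInner k ≤ ‖x‖ ∧ ‖x‖ ≤ 2 ^ k ∧ x = (-1) ^ k * (‖x‖ : ℂ) := by
  obtain ⟨a, ⟨ha1, ha2⟩, rfl⟩ := hx
  have h0 := (tesseraInner_le k).1.trans ha1
  have : ‖(-1 : ℂ) ^ k * (a : ℂ)‖ = a := by simp [abs_of_nonneg h0]
  rw [this]
  exact ⟨ha1, ha2, rfl⟩

lemma im_of_mem_tesseraSegment {k : ℕ} {x : ℂ} (hx : x ∈ tesseraSegment k) : x.im = 0 := by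
  obtain ⟨a, -, rfl⟩ := hx
  rw [neg_one_pow_eq_ofReal, ← Complex.ofReal_mul, Complex.ofReal_im]

/-- The modulus of a point of stage `k`. -/
lemma norm_of_mem_stage {k : ℕ} {x : ℂ} (hx : x ∈ tesseraSegment k ∪ tesseraArc k) :
    tesseraInner k ≤ ‖x‖ ∧ ‖x‖ ≤ 2 ^ k := by
  rcases hx with hx | hx
  · exact ⟨(norm_of_mem_tesseraSegment hx).1, (norm_of_mem_tesseraSegment hx).2.1⟩
  · rw [hx.1]; exact ⟨(tesseraInner_le k).2.le, le_rfl⟩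

lemma two_pow_le_tesseraInner {j k : ℕ} (h : j < k) : (2 : ℝ) ^ j ≤ tesseraInner k := by
  cases k with
  | zero => omega
  | succ k => exact pow_le_pow_right₀ (by norm_num) (by omega)

/-- A point of the curve whose modulus lies strictly between those of the ends of a segment
belongs to that segment. -/
lemma mem_tesseraSegment_of_norm {k : ℕ} {y : ℂ} (hy : y ∈ tesseraCurve)
    (h1 : tesseraInner k < ‖y‖) (h2 : ‖y‖ < 2 ^ k) : y ∈ tesseraSegment k := by
  rw [tesseraCurve_eq_iUnion] at hy
  obtain ⟨j, hj⟩ := mem_iUnion.mp hy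
  have hn := norm_of_mem_stage hj
  rcases lt_trichotomy j k with h | h | h
  · linarith [two_pow_le_tesseraInner h]
  · subst h
    rcases hj with hj | hj
    · exact hj
    · exact absurd hj.1 h2.ne
  · linarith [two_pow_le_tesseraInner h]

lemma mem_tesseraArc_iff {k : ℕ} {x : ℂ} : x ∈ tesseraArc k ↔
    ∃ θ ∈ Icc 0 Real.pi, x = (-1) ^ k * 2 ^ k * Complex.exp (θ * Complex.I) := by
  constructor
  · rintro ⟨hz, him⟩
    set w : ℂ := (-1) ^ k * x with hw
    have hwn : ‖w‖ = 2 ^ k := by rw [hw, norm_mul, hz]; simp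
    have hwi : 0 ≤ w.im := by rw [hw, neg_one_pow_eq_ofReal, Complex.im_ofReal_mul]; exact him
    refine ⟨w.arg, ⟨Complex.arg_nonneg_iff.mpr hwi, Complex.arg_le_pi w⟩, ?_⟩
    have h4 := Complex.norm_mul_exp_arg_mul_I w
    rw [hwn] at h4
    push_cast at h4
    rw [mul_assoc, h4, hw, ← mul_assoc, neg_one_pow_mul_self, one_mul]
  · rintro ⟨θ, ⟨h0, h1⟩, rfl⟩
    refine ⟨by rw [norm_mul, Complex.norm_exp_ofReal_mul_I]; simp, ?_⟩
    have h3 : (-1 : ℂ) ^ k * 2 ^ k = (((-1 : ℝ) ^ k * 2 ^ k : ℝ) : ℂ) := by push_cast; rfl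
    rw [h3, Complex.im_ofReal_mul, Complex.exp_ofReal_mul_I_im, ← mul_assoc, ← mul_assoc,
      neg_one_pow_mul_self, one_mul]
    exact mul_nonneg (by positivity) (Real.sin_nonneg_of_nonneg_of_le_pi h0 h1)

/-- A real number of modulus `2 ^ k` lies on the half-circle of stage `k`. -/
lemma mem_tesseraArc_of_im_eq_zero {k : ℕ} {x : ℂ} (h : ‖x‖ = 2 ^ k) (him : x.im = 0) :
    x ∈ tesseraArc k := ⟨h, by rw [him, mul_zero]⟩

/-- A point of the curve of modulus `2 ^ k` lies on the half-circle of stage `k`. -/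
lemma mem_tesseraArc_of_norm {k : ℕ} {y : ℂ} (hy : y ∈ tesseraCurve) (h : ‖y‖ = 2 ^ k) :
    y ∈ tesseraArc k := by
  rw [tesseraCurve_eq_iUnion] at hy
  obtain ⟨j, hj | hj⟩ := mem_iUnion.mp hy
  · exact mem_tesseraArc_of_im_eq_zero h (im_of_mem_tesseraSegment hj)
  · have : (2 : ℝ) ^ j = 2 ^ k := hj.1.symm.trans h
    rwa [pow_right_injective₀ (by norm_num) (by norm_num) this] at hj

lemma im_eq_zero_of_mem_tesseraCurve {y : ℂ} (hy : y ∈ tesseraCurve) (h : ∀ k : ℕ, ‖y‖ ≠ 2 ^ k) :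
    y.im = 0 := by
  rw [tesseraCurve_eq_iUnion] at hy
  obtain ⟨j, hj | hj⟩ := mem_iUnion.mp hy
  · exact im_of_mem_tesseraSegment hj
  · exact absurd hj.1 (h j)

/-! ### Connectedness -/

lemma isPreconnected_tesseraSegment (k : ℕ) : IsPreconnected (tesseraSegment k) := by
  have : tesseraSegment k = (fun a : ℝ => (-1) ^ k * (a : ℂ)) '' Icc (tesseraInner k) (2 ^ k) := by
    ext z; simp only [tesseraSegment, mem_ofPred_eq, mem_image, eq_comm]
  rw [this]
  exact isPreconnected_Icc.image _ (by fun_prop)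

lemma isPreconnected_tesseraArc (k : ℕ) : IsPreconnected (tesseraArc k) := by
  have : tesseraArc k = (fun θ : ℝ => (-1) ^ k * 2 ^ k * Complex.exp (θ * Complex.I)) ''
      Icc 0 Real.pi := by
    ext z; rw [mem_tesseraArc_iff]; simp only [mem_image, eq_comm]
  rw [this]
  exact isPreconnected_Icc.image _ (by fun_prop)

lemma neg_one_pow_mul_two_pow_mem (j k : ℕ) : (-1 : ℂ) ^ j * 2 ^ k ∈ tesseraArc k :=
  mem_tesseraArc_of_im_eq_zero (by simp) (by
    have : (-1 : ℂ) ^ j * 2 ^ k = (((-1 : ℝ) ^ j * 2 ^ k : ℝ) : ℂ) := by push_cast; rfl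
    rw [this, Complex.ofReal_im])

/-- Within stage `k` the two pieces share `(-1) ^ k * 2 ^ k`; stages `k` and `k + 1` share the
opposite point. -/
lemma isPreconnected_tesseraCurve : IsPreconnected tesseraCurve := by
  rw [tesseraCurve_eq_iUnion]
  refine IsPreconnected.iUnion_of_chain (fun k => ?_) fun k => ?_
  · refine IsPreconnected.union ((-1) ^ k * 2 ^ k) ?_ (neg_one_pow_mul_two_pow_mem k k)
      (isPreconnected_tesseraSegment k) (isPreconnected_tesseraArc k)
    exact ⟨2 ^ k, ⟨(tesseraInner_le k).2.le, le_rfl⟩, by push_cast; rfl⟩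
  · refine ⟨(-1) ^ (k + 1) * 2 ^ k, Or.inr (neg_one_pow_mul_two_pow_mem _ _), Or.inl ?_⟩
    refine ⟨2 ^ k, ⟨le_rfl, pow_le_pow_right₀ (by norm_num) (Order.le_succ k)⟩, by push_cast; rfl⟩

instance : PreconnectedSpace tesseraCurve := Subtype.preconnectedSpace isPreconnected_tesseraCurve

/-- Balls of the curve have length at least their radius. -/
lemma ofReal_le_hausdorffMeasure_ball (z : tesseraCurve) (r : ℝ) :
    ENNReal.ofReal r ≤ (μH[1] : Measure tesseraCurve) (ball z r) := by
  have hlip : LipschitzWith 1 fun x : tesseraCurve => dist x z := LipschitzWith.dist_left z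
  have h := hlip.hausdorffMeasure_image_le zero_le_one (ball z r)
  rw [hausdorffMeasure_real] at h
  simp only [ENNReal.coe_one, ENNReal.one_rpow, one_mul] at h
  refine le_trans ?_ h
  -- By connectedness the distance to `z` takes every value between `0` and its value at a far point
  -- `2 ^ k`.
  have : Ico 0 r ⊆ (fun x : tesseraCurve => dist x z) '' ball z r := by
    intro c hc
    obtain ⟨k, hk⟩ := pow_unbounded_of_one_lt (c + ‖(z : ℂ)‖) (by norm_num : (1 : ℝ) < 2)
    obtain ⟨x, hx⟩ := mem_range_of_exists_le_of_exists_ge (c := c) hlip.continuous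
      ⟨z, by simpa using hc.1⟩
      ⟨⟨_, tesseraArc_subset k (neg_one_pow_mul_two_pow_mem 0 k)⟩, by
        simp only [Subtype.dist_eq, dist_eq_norm]
        refine le_trans ?_ (norm_sub_norm_le _ _)
        rw [(neg_one_pow_mul_two_pow_mem 0 k).1]
        linarith⟩
    have hx' : dist x z = c := hx
    exact ⟨x, by rw [mem_ball, hx']; exact hc.2, hx⟩
  calc ENNReal.ofReal r = volume (Ico 0 r) := by rw [Real.volume_Ico, sub_zero]
    _ ≤ _ := measure_mono this

/-! ### Length of a stage inside a ball -/

lemma hausdorffMeasure_tesseraSegment_inter_ball_le (k : ℕ) (p : ℂ) (s : ℝ) :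
    (μH[1] : Measure ℂ) (tesseraSegment k ∩ ball p s) ≤ ENNReal.ofReal (2 * s) := by
  have hsub : tesseraSegment k ∩ ball p s ⊆ (fun a : ℝ => (a : ℂ)) '' ball p.re s := by
    rintro x ⟨hx, hxp⟩
    refine ⟨x.re, ?_, Complex.ext rfl (im_of_mem_tesseraSegment hx).symm⟩
    rw [mem_ball, dist_eq_norm] at hxp ⊢
    exact (Complex.abs_re_le_norm (x - p)).trans_lt hxp
  calc _ ≤ (μH[1] : Measure ℂ) ((fun a : ℝ => (a : ℂ)) '' ball p.re s) := measure_mono hsub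
    _ = volume (ball p.re s) := by
      rw [Complex.isometry_ofReal.hausdorffMeasure_image (Or.inl zero_le_one),
        hausdorffMeasure_real]
    _ = _ := Real.volume_ball _ _

/-- Two points in the ball are `2 s` apart at most, so their angles differ by at most `4 s / 2 ^ k`.
The angular parametrization, `2 ^ k`-Lipschitz, maps an interval of twice that length onto a set
containing the intersection. -/
lemma hausdorffMeasure_tesseraArc_inter_ball_le (k : ℕ) (p : ℂ) (s : ℝ) :
    (μH[1] : Measure ℂ) (tesseraArc k ∩ ball p s) ≤ ENNReal.ofReal (8 * s) := by
  rcases (tesseraArc k ∩ ball p s).eq_empty_or_nonempty with h | ⟨x, hx, hxp⟩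
  · simp [h]
  obtain ⟨θ, hθ, rfl⟩ := mem_tesseraArc_iff.mp hx
  have hk : (0 : ℝ) < 2 ^ k := by positivity
  have hlip : LipschitzWith (2 ^ k)
      fun θ : ℝ => (-1 : ℂ) ^ k * 2 ^ k * Complex.exp (θ * Complex.I) := by
    refine LipschitzWith.of_dist_le_mul fun a b => ?_
    rw [dist_eq_norm, ← mul_sub, norm_mul]
    simpa [Real.dist_eq] using mul_le_mul_of_nonneg_left (norm_exp_mul_I_sub_le a b) hk.le
  have hsub : tesseraArc k ∩ ball p s ⊆
      (fun θ : ℝ => (-1 : ℂ) ^ k * 2 ^ k * Complex.exp (θ * Complex.I)) ''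
        closedBall θ (4 * s / 2 ^ k) := by
    rintro y ⟨hy, hyp⟩
    obtain ⟨φ, hφ, rfl⟩ := mem_tesseraArc_iff.mp hy
    refine ⟨φ, ?_, rfl⟩
    have h1 := (dist_triangle_right _ _ p).trans_lt (add_lt_add hyp hxp)
    rw [dist_eq_norm, ← mul_sub, norm_mul] at h1
    have h2 := abs_sub_le_norm_exp_mul_I_sub (θ := φ) (φ := θ)
      (by rw [abs_le]; constructor <;> linarith [hθ.1, hθ.2, hφ.1, hφ.2])
    have h3 : ‖(-1 : ℂ) ^ k * 2 ^ k‖ = 2 ^ k := by simp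
    rw [h3] at h1
    rw [mem_closedBall, Real.dist_eq, le_div_iff₀ hk]
    nlinarith
  calc _ ≤ _ := measure_mono hsub
    _ ≤ ((2 ^ k : ℝ≥0) : ℝ≥0∞) ^ (1 : ℝ) * μH[1] (closedBall θ (4 * s / 2 ^ k)) :=
      hlip.hausdorffMeasure_image_le zero_le_one _
    _ = _ := by
      rw [hausdorffMeasure_real, Real.volume_closedBall, ENNReal.rpow_one]
      have : ((2 ^ k : ℝ≥0) : ℝ≥0∞) = ENNReal.ofReal (2 ^ k) := by
        rw [ENNReal.ofReal_pow (by norm_num)]; simp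
      rw [this, ← ENNReal.ofReal_mul hk.le]
      congr 1
      field_simp
      ring

/-- The part of the curve traversed in stage `k`. -/
def tesseraStagePart (k : ℕ) : Set tesseraCurve := {x | (x : ℂ) ∈ tesseraSegment k ∪ tesseraArc k}

lemma iUnion_tesseraStagePart : ⋃ k, tesseraStagePart k = univ := by
  refine eq_univ_of_forall fun x => ?_
  have hx : (x : ℂ) ∈ ⋃ k, (tesseraSegment k ∪ tesseraArc k) := tesseraCurve_eq_iUnion ▸ x.2
  obtain ⟨k, hk⟩ := mem_iUnion.mp hx
  exact mem_iUnion.mpr ⟨k, hk⟩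

/-- The centre is any complex number because the crossing points used for layers may lie off the
curve. -/
lemma hausdorffMeasure_stagePart_inter_le (k : ℕ) (p : ℂ) (s : ℝ) :
    (μH[1] : Measure tesseraCurve) (tesseraStagePart k ∩ {x | dist (x : ℂ) p < s})
      ≤ ENNReal.ofReal (10 * s) := by
  rcases lt_or_ge s 0 with hs | hs
  · have : tesseraStagePart k ∩ {x | dist (x : ℂ) p < s} = ∅ :=
      eq_empty_of_forall_notMem fun x hx => by
        have := hx.2; simp only [mem_ofPred_eq] at this; linarith [dist_nonneg (x := (x : ℂ)) (y := p)]
    simp [this]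
  rw [← isometry_subtype_coe.hausdorffMeasure_image (Or.inl zero_le_one)]
  calc _ ≤ (μH[1] : Measure ℂ) ((tesseraSegment k ∩ ball p s) ∪ (tesseraArc k ∩ ball p s)) := by
        refine measure_mono ?_
        rintro _ ⟨x, ⟨hx, hxp⟩, rfl⟩
        exact hx.imp (fun h => ⟨h, hxp⟩) fun h => ⟨h, hxp⟩
    _ ≤ _ := measure_union_le _ _
    _ ≤ ENNReal.ofReal (2 * s) + ENNReal.ofReal (8 * s) :=
      add_le_add (hausdorffMeasure_tesseraSegment_inter_ball_le k p s)
        (hausdorffMeasure_tesseraArc_inter_ball_le k p s)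
    _ = _ := by rw [← ENNReal.ofReal_add (by positivity) (by positivity)]; ring_nf

lemma hausdorffMeasure_stagePart_le (k : ℕ) :
    (μH[1] : Measure tesseraCurve) (tesseraStagePart k) ≤ ENNReal.ofReal (20 * 2 ^ k) := by
  have h := hausdorffMeasure_stagePart_inter_le k 0 (2 * 2 ^ k)
  rw [inter_eq_left.mpr] at h
  · convert h using 2; ring
  · intro x hx
    have : (0 : ℝ) < 2 ^ k := by positivity
    simp only [mem_ofPred_eq, dist_zero_right]
    linarith [(norm_of_mem_stage hx).2]

/-- At most two of the stages of size greater than `8R` meet a ball of radius `R`. -/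
lemma exists_large_stages (w : tesseraCurve) {R : ℝ} (hR : 0 < R) :
    ∃ k₀ : ℕ, ∀ k, 8 * R < 2 ^ k → (tesseraStagePart k ∩ ball w R).Nonempty →
      k = k₀ ∨ k = k₀ + 1 := by
  classical
  by_cases hex : ∃ k : ℕ, 8 * R < 2 ^ k ∧ (tesseraStagePart k ∩ ball w R).Nonempty
  · refine ⟨Nat.find hex, fun k hk hne => ?_⟩
    have hle := Nat.find_min' hex ⟨hk, hne⟩
    obtain ⟨hj, x, hx, hxw⟩ := Nat.find_spec hex
    obtain ⟨y, hy, hyw⟩ := hne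
    set j := Nat.find hex
    by_contra hcon
    have hjk : j + 1 < k := by omega
    -- With a stage between them, the moduli differ by at least `2 ^ j > 8 R`, while two points of
    -- the ball are less than `2 R` apart.
    have h1 := two_pow_le_tesseraInner hjk
    have h2 := (norm_of_mem_stage hx).2
    have h3 := (norm_of_mem_stage hy).1
    have h4 := (dist_triangle_right y x w).trans_lt (add_lt_add hyw hxw)
    rw [Subtype.dist_eq, dist_eq_norm] at h4
    have h5 := norm_sub_norm_le (y : ℂ) x
    rw [pow_succ] at h1
    linarith
  · exact ⟨0, fun k hk hne => absurd ⟨k, hk, hne⟩ hex⟩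

lemma sum_sqrt_two_pow_le (N : ℕ) {R : ℝ} (hN : ∀ k < N, (2 : ℝ) ^ k ≤ 8 * R) :
    ∑ k ∈ Finset.range N, √(2 ^ k) ≤ 12 * √R := by
  have key : ∀ n : ℕ, ∑ k ∈ Finset.range (n + 1), √((2 : ℝ) ^ k) ≤ 4 * √(2 ^ n) := by
    intro n
    induction n with
    | zero => simp
    | succ n ih =>
      rw [Finset.sum_range_succ, pow_succ, Real.sqrt_mul (by positivity)]
      -- The induction closes if `4 + √2 ≤ 4 √2`, that is, `√2 ≥ 4 / 3`.
      have h2 : (4 / 3 : ℝ) ≤ √2 := Real.le_sqrt_of_sq_le (by norm_num)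
      nlinarith [Real.sqrt_nonneg ((2 : ℝ) ^ n)]
  cases N with
  | zero => simp
  | succ n =>
    refine (key n).trans ?_
    have h1 := Real.sqrt_le_sqrt (hN n (by omega))
    rw [Real.sqrt_mul (by norm_num)] at h1
    have h2 : √8 ≤ 3 := by rw [Real.sqrt_le_left (by norm_num)]; norm_num
    nlinarith [Real.sqrt_nonneg R]

/-- A subset of a ball whose intersections with the stages are small is small. -/
lemma hausdorffMeasure_le_of_forall_stagePart {A : Set tesseraCurve} {w : tesseraCurve}
    {M ε R : ℝ} (hM : 0 ≤ M) (hε : 0 < ε) (hεR : ε ≤ R) (hA : A ⊆ ball w R)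
    (h : ∀ k, (μH[1] : Measure tesseraCurve) (tesseraStagePart k ∩ A) ≤
      ENNReal.ofReal (M * min (2 ^ k) ε)) :
    (μH[1] : Measure tesseraCurve) A ≤ ENNReal.ofReal (14 * M * √(ε * R)) := by
  have hR : 0 < R := hε.trans_le hεR
  obtain ⟨k₀, hk₀⟩ := exists_large_stages w hR
  have hex : ∃ n : ℕ, 8 * R < 2 ^ n := pow_unbounded_of_one_lt _ (by norm_num)
  classical
  set N := Nat.find hex
  have hN1 : ∀ k < N, (2 : ℝ) ^ k ≤ 8 * R := fun k hk => not_lt.mp (Nat.find_min hex hk)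
  have hN2 : ∀ k, N ≤ k → 8 * R < 2 ^ k := fun k hk =>
    (Nat.find_spec hex).trans_le (pow_le_pow_right₀ (by norm_num) hk)
  have hsub : A ⊆ (⋃ k ∈ Finset.range N, tesseraStagePart k ∩ A) ∪
      ((tesseraStagePart k₀ ∩ A) ∪ (tesseraStagePart (k₀ + 1) ∩ A)) := by
    intro x hx
    have hx' : x ∈ ⋃ k, tesseraStagePart k := iUnion_tesseraStagePart ▸ mem_univ x
    obtain ⟨k, hk⟩ := mem_iUnion.mp hx'
    rcases lt_or_ge k N with hkN | hkN
    · exact Or.inl (mem_iUnion₂.mpr ⟨k, Finset.mem_range.mpr hkN, hk, hx⟩)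
    · rcases hk₀ k (hN2 k hkN) ⟨x, hk, hA hx⟩ with rfl | rfl
      · exact Or.inr (Or.inl ⟨hk, hx⟩)
      · exact Or.inr (Or.inr ⟨hk, hx⟩)
  have hle : ε ≤ √(ε * R) := Real.le_sqrt_of_sq_le (by nlinarith)
  have hbig : ∀ k, (μH[1] : Measure tesseraCurve) (tesseraStagePart k ∩ A) ≤
      ENNReal.ofReal (M * √(ε * R)) := fun k => (h k).trans <| ENNReal.ofReal_le_ofReal <|
    mul_le_mul_of_nonneg_left ((min_le_right _ _).trans hle) hM
  -- The geometric mean dominates the minimum and makes the sum over small stages geometric. It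
  -- contributes `12`, the two large stages `1` each, whence the constant `14`.
  have hsmall : ∀ k, (μH[1] : Measure tesseraCurve) (tesseraStagePart k ∩ A) ≤
      ENNReal.ofReal (M * √ε * √(2 ^ k)) := fun k => (h k).trans <| ENNReal.ofReal_le_ofReal <| by
    rw [mul_assoc, ← Real.sqrt_mul hε.le]
    refine mul_le_mul_of_nonneg_left (Real.le_sqrt_of_sq_le ?_) hM
    rw [sq, mul_comm ε]
    exact mul_le_mul (min_le_left _ _) (min_le_right _ _) (le_min (by positivity) hε.le)
      (by positivity)
  calc (μH[1] : Measure tesseraCurve) A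
      ≤ ∑ k ∈ Finset.range N, ENNReal.ofReal (M * √ε * √(2 ^ k)) +
        (ENNReal.ofReal (M * √(ε * R)) + ENNReal.ofReal (M * √(ε * R))) := by
        refine (measure_mono hsub).trans <| (measure_union_le _ _).trans <| add_le_add ?_ <|
          (measure_union_le _ _).trans <| add_le_add (hbig _) (hbig _)
        exact (measure_biUnion_finset_le _ _).trans (Finset.sum_le_sum fun k _ => hsmall k)
    _ = ENNReal.ofReal (M * √ε * ∑ k ∈ Finset.range N, √(2 ^ k) +
          (M * √(ε * R) + M * √(ε * R))) := by
        rw [← ENNReal.ofReal_sum_of_nonneg (fun k _ => by positivity), ← Finset.mul_sum,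
          ← ENNReal.ofReal_add (by positivity) (by positivity),
          ← ENNReal.ofReal_add (by positivity) (by positivity)]
    _ ≤ _ := by
        refine ENNReal.ofReal_le_ofReal ?_
        have := mul_le_mul_of_nonneg_left (sum_sqrt_two_pow_le N hN1)
          (by positivity : 0 ≤ M * √ε)
        rw [Real.sqrt_mul hε.le] at *
        linarith

/-- Balls of the curve have length at most a constant times their radius. -/
lemma hausdorffMeasure_ball_le (z : tesseraCurve) {r : ℝ} (hr : 0 < r) :
    (μH[1] : Measure tesseraCurve) (ball z r) ≤ ENNReal.ofReal (280 * r) := by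
  have h := hausdorffMeasure_le_of_forall_stagePart (M := 20) (by norm_num) hr le_rfl
    (Subset.refl (ball z r)) fun k => ?_
  · rw [Real.sqrt_mul_self hr.le] at h
    convert h using 2; ring
  · rw [mul_min_of_nonneg _ _ (by norm_num)]
    rcases min_cases (20 * (2 : ℝ) ^ k) (20 * r) with ⟨h', _⟩ | ⟨h', _⟩ <;> rw [h']
    · exact (measure_mono inter_subset_left).trans (hausdorffMeasure_stagePart_le k)
    · refine (hausdorffMeasure_stagePart_inter_le k z r).trans
        (ENNReal.ofReal_le_ofReal (by linarith))

theorem isAhlforsDavidRegularOne_tesseraCurve :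
    IsAhlforsDavidRegularOne (μH[1] : Measure tesseraCurve) :=
  ⟨280, by norm_num, fun x r hr => ⟨(ENNReal.ofReal_le_ofReal (by linarith)).trans
    (ofReal_le_hausdorffMeasure_ball x r), hausdorffMeasure_ball_le x hr⟩⟩

theorem isHomogeneousType_tesseraCurve :
    IsHomogeneousType (μH[1] : Measure tesseraCurve) := by
  refine ⟨560, fun x r hr => ⟨?_, ?_, ?_⟩⟩
  · exact (ENNReal.ofReal_pos.mpr (by linarith)).trans_le (ofReal_le_hausdorffMeasure_ball x (2 * r))
  · calc _ ≤ ENNReal.ofReal (280 * (2 * r)) := hausdorffMeasure_ball_le x (by linarith)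
      _ = (560 : ℝ≥0) * ENNReal.ofReal r := by
        rw [← mul_assoc, ENNReal.ofReal_mul (by norm_num)]; norm_num
      _ ≤ _ := by gcongr; exact ofReal_le_hausdorffMeasure_ball x r
  · exact (hausdorffMeasure_ball_le x hr).trans_lt ENNReal.ofReal_lt_top

/-! ### Relative layer decay -/

lemma mem_uIcc_of_not_lt_iff {a b r : ℝ} (h : ¬(a < r ↔ b < r)) : r ∈ uIcc a b := by
  rw [mem_uIcc]
  by_cases ha : a < r
  · exact Or.inl ⟨ha.le, not_lt.mp fun hb => h ⟨fun _ => hb, fun _ => ha⟩⟩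
  · exact Or.inr ⟨(not_le.mp fun hb => h ⟨fun h' => absurd h' ha, fun h' => absurd h' hb.not_gt⟩).le,
      not_lt.mp ha⟩

/-- A circle meets the real axis in at most two points. -/
lemma exists_finset_sphere_inter_real (z : ℂ) (r : ℝ) :
    ∃ P : Finset ℂ, P.card ≤ 2 ∧ ∀ p : ℂ, p.im = 0 → ‖p - z‖ = r → p ∈ P := by
  classical
  by_cases h : ∃ p : ℂ, p.im = 0 ∧ ‖p - z‖ = r
  · obtain ⟨p, hp, hpr⟩ := h
    -- The other point is the mirror image of `p` in the vertical line through `z`.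
    refine ⟨{p, (2 * z.re : ℝ) - p}, Finset.card_le_two, fun q hq hqr => ?_⟩
    have h1 : ‖q - z‖ ^ 2 = ‖p - z‖ ^ 2 := by rw [hpr, hqr]
    rw [Complex.sq_norm, Complex.sq_norm, Complex.normSq_apply, Complex.normSq_apply] at h1
    simp only [Complex.sub_re, Complex.sub_im, hp, hq] at h1
    have h2 : (q.re - p.re) * (q.re + p.re - 2 * z.re) = 0 := by linarith
    rw [Finset.mem_insert, Finset.mem_singleton]
    rcases mul_eq_zero.mp h2 with h3 | h3
    · exact Or.inl (Complex.ext (by linarith) (by rw [hp, hq]))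
    · refine Or.inr (Complex.ext ?_ ?_)
      · rw [Complex.sub_re, Complex.ofReal_re]; linarith
      · rw [Complex.sub_im, Complex.ofReal_im, hp, hq, sub_zero]
  · exact ⟨∅, by simp, fun p hp hpr => absurd ⟨p, hp, hpr⟩ h⟩

/-- Two circles with different centres meet in at most two points. -/
lemma exists_finset_sphere_inter_sphere {z : ℂ} (hz : z ≠ 0) (ρ r : ℝ) :
    ∃ P : Finset ℂ, P.card ≤ 2 ∧ ∀ p : ℂ, ‖p‖ = ρ → ‖p - z‖ = r → p ∈ P := by
  classical
  by_cases h : ∃ p : ℂ, ‖p‖ = ρ ∧ ‖p - z‖ = r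
  · obtain ⟨p, hp, hpr⟩ := h
    have hz' : (starRingEnd ℂ) z ≠ 0 := by simpa using hz
    -- The other point is the reflection of `p` in the line through `0` and `z`. Multiplying by the
    -- conjugate of `z` turns that line into the real axis, where the two points have equal real
    -- parts and opposite imaginary parts.
    refine ⟨{p, (starRingEnd ℂ) p * z / (starRingEnd ℂ) z}, Finset.card_le_two,
      fun q hq hqr => ?_⟩
    have h1 : ‖q‖ ^ 2 = ‖p‖ ^ 2 := by rw [hp, hq]
    have h2 : ‖q - z‖ ^ 2 = ‖p - z‖ ^ 2 := by rw [hpr, hqr]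
    simp only [Complex.sq_norm, Complex.normSq_apply, Complex.sub_re, Complex.sub_im] at h1 h2
    set u := q * (starRingEnd ℂ) z with hu
    set v := p * (starRingEnd ℂ) z with hv
    have hre : u.re = v.re := by
      simp only [hu, hv, Complex.mul_re, Complex.conj_re, Complex.conj_im]; linarith
    have him : (u.im - v.im) * (u.im + v.im) = 0 := by
      have h3 : u.re ^ 2 + u.im ^ 2 = v.re ^ 2 + v.im ^ 2 := by
        simp only [hu, hv, Complex.mul_re, Complex.mul_im, Complex.conj_re, Complex.conj_im]
        linear_combination (z.re ^ 2 + z.im ^ 2) * h1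
      rw [hre] at h3
      linarith
    rw [Finset.mem_insert, Finset.mem_singleton]
    rcases mul_eq_zero.mp him with h3 | h3
    · refine Or.inl (mul_right_cancel₀ hz' (Complex.ext hre (by linarith)))
    · refine Or.inr ?_
      rw [eq_div_iff hz', ← hu]
      have h4 : (starRingEnd ℂ) p * z = (starRingEnd ℂ) v := by simp [hv]
      rw [h4]
      exact Complex.ext (by simpa using hre) (by rw [Complex.conj_im]; linarith)
  · exact ⟨∅, by simp, fun p hp hpr => absurd ⟨p, hp, hpr⟩ h⟩

/-- A point of a segment of the curve is close to an endpoint of the segment or to a point where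
the axis meets a given circle, relative to its distance to the other side of the circle. -/
lemma exists_finset_tesseraSegment (k : ℕ) (z : ℂ) (r : ℝ) :
    ∃ P : Finset ℂ, P.card ≤ 4 ∧ ∀ x ∈ tesseraSegment k, ∀ y ∈ tesseraCurve,
      ¬(‖x - z‖ < r ↔ ‖y - z‖ < r) → ∃ p ∈ P, ‖x - p‖ ≤ 4 * ‖x - y‖ := by
  classical
  obtain ⟨P, hP, hPr⟩ := exists_finset_sphere_inter_real z r
  refine ⟨P ∪ {(-1) ^ k * (tesseraInner k : ℂ), (-1) ^ k * 2 ^ k}, ?_, fun x hx y hy hxy => ?_⟩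
  · exact (Finset.card_union_le _ _).trans (add_le_add hP Finset.card_le_two)
  have hn := norm_of_mem_tesseraSegment hx
  have hnn := norm_sub_norm_le x y
  have hnn' := norm_sub_norm_le y x
  rw [norm_sub_rev] at hnn'
  -- If the modulus of `y` is outside the open range of the segment, the distance from `x` to the
  -- corresponding end is at most the gap in modulus, hence at most `‖x - y‖`.
  by_cases h1 : ‖y‖ ≤ tesseraInner k
  · refine ⟨(-1) ^ k * (tesseraInner k : ℂ), by simp, ?_⟩
    have : ‖x - (-1) ^ k * (tesseraInner k : ℂ)‖ = ‖x‖ - tesseraInner k := by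
      conv_lhs => rw [hn.2.2]
      rw [← mul_sub, norm_mul, ← Complex.ofReal_sub, Complex.norm_real]
      simp [abs_of_nonneg (sub_nonneg.mpr hn.1)]
    linarith [norm_nonneg (x - y)]
  by_cases h2 : 2 ^ k ≤ ‖y‖
  · refine ⟨(-1) ^ k * 2 ^ k, by simp, ?_⟩
    have : ‖x - (-1) ^ k * 2 ^ k‖ = 2 ^ k - ‖x‖ := by
      conv_lhs => rw [hn.2.2]
      have h2k : (2 : ℂ) ^ k = ((2 ^ k : ℝ) : ℂ) := by push_cast; rfl
      rw [h2k, ← mul_sub, norm_mul, ← Complex.ofReal_sub, Complex.norm_real]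
      simp only [norm_pow, norm_neg, norm_one, one_pow, one_mul, Real.norm_eq_abs]
      rw [abs_of_nonpos (sub_nonpos.mpr hn.2.1)]; ring
    linarith [norm_nonneg (x - y)]
  -- Otherwise `y` is on the same segment, and the sphere is crossed between `x` and `y`.
  have hy' := mem_tesseraSegment_of_norm hy (not_le.mp h1) (not_le.mp h2)
  have hx0 := im_of_mem_tesseraSegment hx
  have hy0 := im_of_mem_tesseraSegment hy'
  have hxe : ((x.re : ℝ) : ℂ) = x := Complex.ext rfl hx0.symm
  have hye : ((y.re : ℝ) : ℂ) = y := Complex.ext rfl hy0.symm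
  obtain ⟨c, hc, hcr⟩ := intermediate_value_uIcc (a := x.re) (b := y.re)
    (f := fun a : ℝ => ‖(a : ℂ) - z‖) (by fun_prop)
    (show r ∈ _ by simp only [hxe, hye]; exact mem_uIcc_of_not_lt_iff hxy)
  refine ⟨c, Finset.mem_union_left _ (hPr _ (Complex.ofReal_im c) hcr), ?_⟩
  rw [← hxe, ← hye, ← Complex.ofReal_sub, ← Complex.ofReal_sub, Complex.norm_real,
    Complex.norm_real, Real.norm_eq_abs, Real.norm_eq_abs, abs_sub_comm]
  have := abs_sub_left_of_mem_uIcc hc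
  rw [abs_sub_comm x.re y.re]
  linarith [abs_nonneg (y.re - x.re)]

/-- A point of a half-circle of the curve is close to an endpoint of the half-circle, relative to
its distance to the rest of the curve. -/
lemma exists_endpoint_tesseraArc {k : ℕ} {x y : ℂ} (hx : x ∈ tesseraArc k) (hy : y ∈ tesseraCurve)
    (hyk : y ∉ tesseraArc k) :
    ‖x - 2 ^ k‖ ≤ 4 * ‖x - y‖ ∨ ‖x - -2 ^ k‖ ≤ 4 * ‖x - y‖ := by
  have hk : (0 : ℝ) < 2 ^ k := by positivity
  have hnn := norm_sub_norm_le x y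
  have hnn' := norm_sub_norm_le y x
  rw [norm_sub_rev] at hnn'
  rw [hx.1] at hnn hnn'
  have htri : ‖x - 2 ^ k‖ ≤ 2 * 2 ^ k := by
    refine (norm_sub_le _ _).trans ?_
    rw [hx.1, norm_pow, Complex.norm_two]; linarith
  -- If `y` is this far in modulus, then `‖x - y‖ ≥ 2 ^ k / 2`, while either endpoint is within `2 *
  -- 2 ^ k` of `x`: this is where the factor `4` comes from.
  by_cases h1 : ‖y‖ ≤ 2 ^ k / 2
  · left; linarith
  by_cases h2 : 2 * 2 ^ k ≤ ‖y‖
  · left; linarith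
  rw [not_le] at h1 h2
  -- In the remaining range of moduli the only half-circle is that of stage `k`, so `y` is real. The
  -- endpoint on its side is within `‖x - y‖` of `y`.
  have him : y.im = 0 := by
    refine im_eq_zero_of_mem_tesseraCurve hy fun j hj => ?_
    rw [hj] at h1 h2
    have hjk : j < k + 1 := by
      rw [← pow_lt_pow_iff_right₀ (by norm_num : (1 : ℝ) < 2), pow_succ]; linarith
    have hkj : k < j + 1 := by
      rw [← pow_lt_pow_iff_right₀ (by norm_num : (1 : ℝ) < 2), pow_succ]; linarith
    obtain rfl : j = k := by omega
    exact hyk (mem_tesseraArc_of_norm hy hj)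
  have hye : ((y.re : ℝ) : ℂ) = y := Complex.ext rfl him.symm
  have hyn : ‖y‖ = |y.re| := by rw [← hye, Complex.norm_real]; rfl
  have h3 : |‖y‖ - 2 ^ k| ≤ ‖x - y‖ := abs_le.mpr ⟨by linarith, by linarith⟩
  have h2k : (2 : ℂ) ^ k = ((2 ^ k : ℝ) : ℂ) := by push_cast; rfl
  rcases le_total 0 y.re with h | h
  · left
    refine (norm_sub_le_norm_sub_add_norm_sub x y _).trans ?_
    have : ‖y - 2 ^ k‖ = |‖y‖ - 2 ^ k| := by
      rw [hyn, abs_of_nonneg h, ← hye, h2k, ← Complex.ofReal_sub, Complex.norm_real]; rfl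
    linarith [norm_nonneg (x - y)]
  · right
    refine (norm_sub_le_norm_sub_add_norm_sub x y _).trans ?_
    have : ‖y - -2 ^ k‖ = |‖y‖ - 2 ^ k| := by
      rw [hyn, abs_of_nonpos h, ← hye, h2k, ← Complex.ofReal_neg, ← Complex.ofReal_sub,
        Complex.norm_real, Real.norm_eq_abs, ← abs_neg, Complex.ofReal_re]
      ring_nf
    linarith [norm_nonneg (x - y)]

/-- A point of a half-circle of the curve is close to an endpoint of the half-circle or to a point
where it meets a given circle, relative to its distance to the other side of the circle. -/
lemma exists_finset_tesseraArc (k : ℕ) (z : ℂ) (r : ℝ) :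
    ∃ P : Finset ℂ, P.card ≤ 4 ∧ ∀ x ∈ tesseraArc k, ∀ y ∈ tesseraCurve,
      ¬(‖x - z‖ < r ↔ ‖y - z‖ < r) → ∃ p ∈ P, ‖x - p‖ ≤ 4 * ‖x - y‖ := by
  classical
  have hk : (0 : ℝ) < 2 ^ k := by positivity
  -- For `z = 0` the circles may coincide, but no crossing point is needed: the half-circle is then
  -- on one side, and `y` cannot belong to it.
  obtain ⟨P, hP, hPr⟩ : ∃ P : Finset ℂ, P.card ≤ 2 ∧ ∀ p : ℂ, z ≠ 0 → ‖p‖ = 2 ^ k →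
      ‖p - z‖ = r → p ∈ P := by
    by_cases hz : z = 0
    · exact ⟨∅, by simp, fun p h => absurd hz h⟩
    · obtain ⟨P, hP, hPr⟩ := exists_finset_sphere_inter_sphere hz (2 ^ k) r
      exact ⟨P, hP, fun p _ => hPr p⟩
  refine ⟨P ∪ {2 ^ k, -2 ^ k}, ?_, fun x hx y hy hxy => ?_⟩
  · exact (Finset.card_union_le _ _).trans (add_le_add hP Finset.card_le_two)
  by_cases hyk : y ∈ tesseraArc k
  · have hz : z ≠ 0 := by
      rintro rfl
      rw [sub_zero, sub_zero, hx.1, hyk.1] at hxy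
      exact hxy Iff.rfl
    obtain ⟨θ, hθ, rfl⟩ := mem_tesseraArc_iff.mp hx
    obtain ⟨φ, hφ, rfl⟩ := mem_tesseraArc_iff.mp hyk
    obtain ⟨c, hc, hcr⟩ := intermediate_value_uIcc (a := θ) (b := φ)
      (f := fun a : ℝ => ‖(-1) ^ k * 2 ^ k * Complex.exp (a * Complex.I) - z‖) (by fun_prop)
      (mem_uIcc_of_not_lt_iff hxy)
    refine ⟨_, Finset.mem_union_left _ (hPr _ hz ?_ hcr), ?_⟩
    · rw [norm_mul, Complex.norm_exp_ofReal_mul_I]; simp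
    · have h3 : ‖(-1 : ℂ) ^ k * 2 ^ k‖ = 2 ^ k := by simp
      rw [← mul_sub, ← mul_sub, norm_mul (_ * _), norm_mul (_ * _), h3]
      have h1 := norm_exp_mul_I_sub_le θ c
      have h2 := abs_sub_le_norm_exp_mul_I_sub (θ := θ) (φ := φ)
        (by rw [abs_le]; constructor <;> linarith [hθ.1, hθ.2, hφ.1, hφ.2])
      have h4 := abs_sub_left_of_mem_uIcc hc
      rw [abs_sub_comm c, abs_sub_comm φ] at h4
      nlinarith [norm_nonneg (Complex.exp (θ * Complex.I) - Complex.exp (φ * Complex.I))]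
  · rcases exists_endpoint_tesseraArc hx hy hyk with h | h
    · exact ⟨_, by simp, h⟩
    · exact ⟨_, by simp, h⟩

/-- A point of the layer of a set has points on the other side of the boundary nearby. -/
lemma exists_dist_lt_of_mem_layer {X : Type*} [MetricSpace X] {B : Set X} {ε : ℝ} (hε : 0 < ε)
    {x : X} (hx : x ∈ layer B ε) : ∃ y, ¬(x ∈ B ↔ y ∈ B) ∧ dist x y < 2 * ε := by
  have hlt : ENNReal.ofReal ε < ENNReal.ofReal (2 * ε) :=
    (ENNReal.ofReal_lt_ofReal_iff (by linarith)).mpr (by linarith)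
  rcases hx with ⟨hxB, h⟩ | ⟨hxB, h⟩
  · obtain ⟨y, hy, hxy⟩ := infEDist_lt_iff.mp (h.trans_lt hlt)
    rw [edist_dist, ENNReal.ofReal_lt_ofReal_iff (by linarith)] at hxy
    exact ⟨y, fun h' => hy (h'.mp hxB), hxy⟩
  · obtain ⟨y, hy, hxy⟩ := infEDist_lt_iff.mp (h.trans_lt hlt)
    rw [edist_dist, ENNReal.ofReal_lt_ofReal_iff (by linarith)] at hxy
    exact ⟨y, fun h' => hxB (h'.mpr hy), hxy⟩

/-- At most `8` reference points serve the stage. A layer point is less than `4 * 2 ε < 9 ε` from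
one of them, and each such ball meets the stage in length at most `90 ε`. -/
lemma hausdorffMeasure_stagePart_inter_layer_le (k : ℕ) (z : tesseraCurve) (r : ℝ) {ε : ℝ}
    (hε : 0 < ε) : (μH[1] : Measure tesseraCurve) (tesseraStagePart k ∩ layer (ball z r) ε) ≤
      ENNReal.ofReal (720 * ε) := by
  classical
  obtain ⟨P, hP, hPx⟩ := exists_finset_tesseraSegment k z r
  obtain ⟨Q, hQ, hQx⟩ := exists_finset_tesseraArc k z r
  have hsub : tesseraStagePart k ∩ layer (ball z r) ε ⊆
      ⋃ p ∈ P ∪ Q, tesseraStagePart k ∩ {x | dist (x : ℂ) p < 9 * ε} := by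
    rintro x ⟨hxk, hx⟩
    obtain ⟨y, hxy, hd⟩ := exists_dist_lt_of_mem_layer hε hx
    simp only [mem_ball, Subtype.dist_eq, dist_eq_norm] at hxy hd
    obtain ⟨p, hp, hxp⟩ : ∃ p ∈ P ∪ Q, ‖(x : ℂ) - p‖ ≤ 4 * ‖(x : ℂ) - y‖ := by
      rcases hxk with hxk | hxk
      · obtain ⟨p, hp, h⟩ := hPx x hxk y y.2 hxy
        exact ⟨p, Finset.mem_union_left _ hp, h⟩
      · obtain ⟨p, hp, h⟩ := hQx x hxk y y.2 hxy
        exact ⟨p, Finset.mem_union_right _ hp, h⟩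
    refine mem_iUnion₂.mpr ⟨p, hp, hxk, ?_⟩
    rw [mem_ofPred_eq, dist_eq_norm]
    linarith
  calc _ ≤ ∑ p ∈ P ∪ Q, (μH[1] : Measure tesseraCurve)
          (tesseraStagePart k ∩ {x | dist (x : ℂ) p < 9 * ε}) :=
        (measure_mono hsub).trans (measure_biUnion_finset_le _ _)
    _ ≤ ∑ p ∈ P ∪ Q, ENNReal.ofReal (10 * (9 * ε)) :=
        Finset.sum_le_sum fun p _ => hausdorffMeasure_stagePart_inter_le k p _
    _ ≤ 8 * ENNReal.ofReal (10 * (9 * ε)) := by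
        rw [Finset.sum_const, nsmul_eq_mul]
        gcongr
        exact_mod_cast (Finset.card_union_le P Q).trans (add_le_add hP hQ)
    _ = _ := by
        have : (8 : ℝ≥0∞) = ENNReal.ofReal 8 := by simp
        rw [this, ← ENNReal.ofReal_mul (by norm_num)]
        ring_nf

lemma hausdorffMeasure_layer_inter_ball_le (z : tesseraCurve) (r : ℝ) (w : tesseraCurve)
    {R ε : ℝ} (hR : 0 < R) (hε : 0 < ε) :
    (μH[1] : Measure tesseraCurve) (layer (ball z r) ε ∩ ball w R) ≤
      ENNReal.ofReal (10080 * √(ε * R)) := by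
  rcases le_or_gt ε R with h | h
  · have := hausdorffMeasure_le_of_forall_stagePart (M := 720) (by norm_num) hε h
      (inter_subset_right : layer (ball z r) ε ∩ ball w R ⊆ ball w R) fun k => ?_
    · convert this using 2; ring
    · rw [mul_min_of_nonneg _ _ (by norm_num)]
      rcases min_cases (720 * (2 : ℝ) ^ k) (720 * ε) with ⟨h', _⟩ | ⟨h', _⟩ <;> rw [h']
      · refine (measure_mono inter_subset_left).trans <| (hausdorffMeasure_stagePart_le k).trans <|
          ENNReal.ofReal_le_ofReal ?_
        have : (0 : ℝ) < 2 ^ k := by positivity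
        linarith
      · exact (measure_mono (inter_subset_inter_right _ inter_subset_left)).trans
          (hausdorffMeasure_stagePart_inter_layer_le k z r hε)
  · refine (measure_mono inter_subset_right).trans <| (hausdorffMeasure_ball_le w hR).trans <|
      ENNReal.ofReal_le_ofReal ?_
    have : R ≤ √(ε * R) := Real.le_sqrt_of_sq_le (by nlinarith)
    linarith [Real.sqrt_nonneg (ε * R)]

theorem relativeLayerDecay_tesseraCurve :
    RelativeLayerDecay (μH[1] : Measure tesseraCurve) := by
  refine ⟨1 / 2, by norm_num, 10080, fun z r _ w R hR _ ε hε => ?_⟩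
  calc _ ≤ ENNReal.ofReal (10080 * √(ε * R)) := hausdorffMeasure_layer_inter_ball_le z r w hR hε
    _ = (10080 : ℝ≥0) * ENNReal.ofReal ((ε / R) ^ (1 / 2 : ℝ)) * ENNReal.ofReal R := by
      have h1 : (ε / R) ^ (1 / 2 : ℝ) * R = √(ε * R) := by
        rw [← Real.sqrt_eq_rpow, Real.sqrt_div hε.le, Real.sqrt_mul hε.le, div_mul_eq_mul_div,
          mul_div_assoc, Real.div_sqrt]
      rw [mul_assoc, ← ENNReal.ofReal_mul (by positivity), h1, ENNReal.ofReal_mul (by norm_num)]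
      norm_num
    _ ≤ _ := by gcongr; exact ofReal_le_hausdorffMeasure_ball w R

/-! ### Schur's test -/

/-- Schur's test for the bilinear form with kernel `k`, for weights `a` and `b`. -/
theorem lintegral_lintegral_le_of_schur {α β : Type*} [MeasurableSpace α] [MeasurableSpace β]
    {μ : Measure α} {ν : Measure β} [SFinite μ] [SFinite ν] {p q : ℝ} (hpq : p.HolderConjugate q)
    {k : α → β → ℝ≥0∞} (hk : Measurable (Function.uncurry k))
    {a : α → ℝ≥0∞} {b : β → ℝ≥0∞} (ha : Measurable a) (hb : Measurable b)
    (ha' : ∀ᵐ y ∂μ, a y ≠ 0 ∧ a y ≠ ∞) (hb' : ∀ᵐ x ∂ν, b x ≠ 0 ∧ b x ≠ ∞) {C : ℝ≥0}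
    (h₁ : ∀ᵐ y ∂μ, ∫⁻ x, k y x * b x ^ (-p) ∂ν ≤ C * a y ^ (-p))
    (h₂ : ∀ᵐ x ∂ν, ∫⁻ y, k y x * a y ^ (-q) ∂μ ≤ C * b x ^ (-q))
    {F : α → ℝ≥0∞} {G : β → ℝ≥0∞} (hF : AEMeasurable F μ) (hG : AEMeasurable G ν) :
    ∫⁻ y, ∫⁻ x, F y * G x * k y x ∂ν ∂μ ≤
      C * (∫⁻ y, F y ^ p ∂μ) ^ (1 / p) * (∫⁻ x, G x ^ q ∂ν) ^ (1 / q) := by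
  have hp := hpq.pos
  have hq := hpq.symm.pos
  have hsum : 1 / p + 1 / q = 1 := by simpa using hpq.inv_add_inv_eq_one
  -- The integrand is split as `u * v` for Hölder on the product. Integrating `u ^ p` first in `x`
  -- calls for `h₁`, and `v ^ q` first in `y` for `h₂`.
  set u : α × β → ℝ≥0∞ := fun w => F w.1 * (k w.1 w.2 ^ (1 / p) * (b w.2)⁻¹ * a w.1) with hu
  set v : α × β → ℝ≥0∞ := fun w => G w.2 * (k w.1 w.2 ^ (1 / q) * b w.2 * (a w.1)⁻¹) with hv
  have hkm : Measurable fun w : α × β => k w.1 w.2 := hk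
  have hum : AEMeasurable u (μ.prod ν) := hF.comp_fst.mul (by fun_prop)
  have hvm : AEMeasurable v (μ.prod ν) := hG.comp_snd.mul (by fun_prop)
  have hrpow : ∀ {s t : ℝ≥0∞} {r : ℝ}, 0 < r → (t ^ (1 / r) * s) ^ r = t * s ^ r := by
    intro s t r hr
    rw [ENNReal.mul_rpow_of_nonneg _ _ hr.le, ← ENNReal.rpow_mul, one_div_mul_cancel hr.ne',
      ENNReal.rpow_one]
  have huv : ∫⁻ y, ∫⁻ x, F y * G x * k y x ∂ν ∂μ = ∫⁻ w, (u * v) w ∂(μ.prod ν) := by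
    rw [lintegral_prod _ (hum.mul hvm)]
    refine lintegral_congr_ae ?_
    filter_upwards [ha'] with y hy
    refine lintegral_congr_ae ?_
    filter_upwards [hb'] with x hx
    have hk1 : k y x ^ (1 / p) * k y x ^ (1 / q) = k y x := by
      rw [← ENNReal.rpow_add_of_nonneg _ _ (by positivity) (by positivity), hsum,
        ENNReal.rpow_one]
    have ha1 := ENNReal.mul_inv_cancel hy.1 hy.2
    have hb1 := ENNReal.mul_inv_cancel hx.1 hx.2
    calc F y * G x * k y x
        = F y * G x * (k y x ^ (1 / p) * k y x ^ (1 / q)) * (a y * (a y)⁻¹) *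
            (b x * (b x)⁻¹) := by rw [ha1, hb1, hk1, mul_one, mul_one]
      _ = (u * v) (y, x) := by simp only [hu, hv, Pi.mul_apply]; ring
  have hU : ∫⁻ w, u w ^ p ∂(μ.prod ν) ≤ C * ∫⁻ y, F y ^ p ∂μ := by
    rw [lintegral_prod _ (hum.pow_const p), ← lintegral_const_mul'' _ (hF.pow_const p)]
    refine lintegral_mono_ae ?_
    filter_upwards [ha', h₁] with y hy h1
    have hky : Measurable fun x => k y x := hk.of_uncurry_left
    calc ∫⁻ x, u (y, x) ^ p ∂ν
        = ∫⁻ x, F y ^ p * a y ^ p * (k y x * b x ^ (-p)) ∂ν := by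
          refine lintegral_congr fun x => ?_
          simp only [hu]
          rw [ENNReal.mul_rpow_of_nonneg _ _ hp.le, mul_assoc (k y x ^ (1 / p)), hrpow hp,
            ENNReal.mul_rpow_of_nonneg _ _ hp.le, ENNReal.inv_rpow, ENNReal.rpow_neg]
          ring
      _ = F y ^ p * a y ^ p * ∫⁻ x, k y x * b x ^ (-p) ∂ν :=
          lintegral_const_mul _ (by fun_prop)
      _ ≤ F y ^ p * a y ^ p * (C * a y ^ (-p)) := by gcongr
      _ = C * F y ^ p * (a y ^ p * a y ^ (-p)) := by ring
      _ = C * F y ^ p := by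
          rw [← ENNReal.rpow_add _ _ hy.1 hy.2, add_neg_cancel, ENNReal.rpow_zero, mul_one]
  have hV : ∫⁻ w, v w ^ q ∂(μ.prod ν) ≤ C * ∫⁻ x, G x ^ q ∂ν := by
    rw [lintegral_prod_symm _ (hvm.pow_const q), ← lintegral_const_mul'' _ (hG.pow_const q)]
    refine lintegral_mono_ae ?_
    filter_upwards [hb', h₂] with x hx h2
    have hkx : Measurable fun y => k y x := hk.of_uncurry_right
    calc ∫⁻ y, v (y, x) ^ q ∂μ
        = ∫⁻ y, G x ^ q * b x ^ q * (k y x * a y ^ (-q)) ∂μ := by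
          refine lintegral_congr fun y => ?_
          simp only [hv]
          rw [ENNReal.mul_rpow_of_nonneg _ _ hq.le, mul_assoc (k y x ^ (1 / q)), hrpow hq,
            ENNReal.mul_rpow_of_nonneg _ _ hq.le, ENNReal.inv_rpow, ENNReal.rpow_neg]
          ring
      _ = G x ^ q * b x ^ q * ∫⁻ y, k y x * a y ^ (-q) ∂μ :=
          lintegral_const_mul _ (by fun_prop)
      _ ≤ G x ^ q * b x ^ q * (C * b x ^ (-q)) := by gcongr
      _ = C * G x ^ q * (b x ^ q * b x ^ (-q)) := by ring
      _ = C * G x ^ q := by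
          rw [← ENNReal.rpow_add _ _ hx.1 hx.2, add_neg_cancel, ENNReal.rpow_zero, mul_one]
  calc ∫⁻ y, ∫⁻ x, F y * G x * k y x ∂ν ∂μ
      = ∫⁻ w, (u * v) w ∂(μ.prod ν) := huv
    _ ≤ (∫⁻ w, u w ^ p ∂(μ.prod ν)) ^ (1 / p) * (∫⁻ w, v w ^ q ∂(μ.prod ν)) ^ (1 / q) :=
        ENNReal.lintegral_mul_le_Lp_mul_Lq _ hpq hum hvm
    _ ≤ (C * ∫⁻ y, F y ^ p ∂μ) ^ (1 / p) * (C * ∫⁻ x, G x ^ q ∂ν) ^ (1 / q) := by gcongr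
    _ = ((C : ℝ≥0∞) ^ (1 / p) * (C : ℝ≥0∞) ^ (1 / q)) * (∫⁻ y, F y ^ p ∂μ) ^ (1 / p) *
          (∫⁻ x, G x ^ q ∂ν) ^ (1 / q) := by
        rw [ENNReal.mul_rpow_of_nonneg _ _ (by positivity),
          ENNReal.mul_rpow_of_nonneg _ _ (by positivity)]
        ring
    _ = _ := by
        rw [← ENNReal.rpow_add_of_nonneg _ _ (by positivity) (by positivity), hsum,
          ENNReal.rpow_one]

/-! ### Layer decay implies the Hardy property -/

section LayerDecay

variable {X : Type*} [MetricSpace X]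

/-- The distance of a point to the other side of a set `B`: the distance to `Bᶜ` for points
of `B`, and the distance to `B` for points of `Bᶜ`. -/
noncomputable def sideDist (B : Set X) (x : X) : ℝ≥0∞ := infEDist x B + infEDist x Bᶜ

lemma sideDist_of_mem {B : Set X} {x : X} (hx : x ∈ B) : sideDist B x = infEDist x Bᶜ := by
  rw [sideDist, infEDist_zero_of_mem hx, zero_add]

lemma sideDist_of_notMem {B : Set X} {x : X} (hx : x ∉ B) : sideDist B x = infEDist x B := by
  rw [sideDist, infEDist_zero_of_mem (show x ∈ Bᶜ from hx), add_zero]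

lemma sideDist_le_edist_of_mem {B : Set X} {x y : X} (hx : x ∈ B) (hy : y ∉ B) :
    sideDist B x ≤ edist x y := by
  rw [sideDist_of_mem hx]; exact infEDist_le_edist_of_mem hy

lemma sideDist_le_edist_of_notMem {B : Set X} {x y : X} (hx : x ∉ B) (hy : y ∈ B) :
    sideDist B x ≤ edist x y := by
  rw [sideDist_of_notMem hx]; exact infEDist_le_edist_of_mem hy

/-- Layers are sublevel sets of one function, so layer decay controls the distribution of that
function. -/
lemma layer_eq_sideDist_le (B : Set X) (ε : ℝ) :
    layer B ε = {x | sideDist B x ≤ ENNReal.ofReal ε} := by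
  ext x
  by_cases hx : x ∈ B
  · simp [layer, hx, sideDist_of_mem hx]
  · simp [layer, hx, sideDist_of_notMem hx]

variable [MeasurableSpace X] {μ : Measure X}

/-- Layers decay at the rate `√ε`, uniformly over all balls. -/
def SqrtLayerDecay (μ : Measure X) (K : ℝ) : Prop :=
  ∀ (z : X) (r : ℝ) (w : X) (R ε : ℝ), 0 < R → 0 < ε →
    μ (layer (ball z r) ε ∩ ball w R) ≤ ENNReal.ofReal (K * √(ε * R))

/-- The zero set lies in every layer, so its part in each fixed ball has measure at most a bound
that tends to `0` with `ε`. -/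
lemma SqrtLayerDecay.ae_sideDist_ne_zero {K : ℝ} (h : SqrtLayerDecay μ K) (z : X) (r : ℝ) :
    ∀ᵐ x ∂μ, sideDist (ball z r) x ≠ 0 := by
  rw [ae_iff]
  simp only [ne_eq, not_not]
  have hsub : {x | sideDist (ball z r) x = 0} ⊆
      ⋃ n : ℕ, {x | sideDist (ball z r) x = 0} ∩ ball z ((n : ℝ) + 1) := by
    intro x hx
    obtain ⟨n, hn⟩ := exists_nat_gt (dist x z)
    exact mem_iUnion.mpr ⟨n, hx, by rw [mem_ball]; linarith⟩
  refine measure_mono_null hsub (measure_iUnion_null fun n => ?_)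
  have hlim : Filter.Tendsto (fun ε : ℝ => ENNReal.ofReal (K * √(ε * ((n : ℝ) + 1))))
      (nhdsWithin 0 (Ioi 0)) (nhds 0) := by
    have : Continuous fun ε : ℝ => ENNReal.ofReal (K * √(ε * ((n : ℝ) + 1))) :=
      ENNReal.continuous_ofReal.comp (by fun_prop)
    simpa using (this.tendsto 0).mono_left nhdsWithin_le_nhds
  refine le_antisymm (ge_of_tendsto hlim ?_) zero_le
  filter_upwards [self_mem_nhdsWithin] with ε hε
  refine (measure_mono (inter_subset_inter_left _ ?_)).trans
    (h z r z ((n : ℝ) + 1) ε (by positivity) hε)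
  rw [layer_eq_sideDist_le]
  intro x hx
  rw [mem_ofPred_eq] at hx ⊢
  rw [hx]
  exact zero_le

variable [BorelSpace X]

lemma measurable_sideDist (B : Set X) : Measurable (sideDist B) :=
  measurable_infEDist.add measurable_infEDist

/-- The test for the weight `sideDist ^ (-α)`. -/
lemma SqrtLayerDecay.exists_lintegral_le {K : ℝ} (hK : 0 ≤ K) (h : SqrtLayerDecay μ K) {α : ℝ}
    (hα : 0 < α) (hα' : α < 1 / 2) : ∃ C : ℝ≥0, ∀ (z : X) (r : ℝ) (p : X) (S : Set X),
      MeasurableSet S → sideDist (ball z r) p ≠ 0 →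
      (∀ x ∈ S, sideDist (ball z r) x ≠ 0 ∧ sideDist (ball z r) x ≤ edist x p ∧
        sideDist (ball z r) p ≤ edist x p) →
      ∫⁻ x in S, (edist x p)⁻¹ * sideDist (ball z r) x ^ (-α) ∂μ ≤
        C * sideDist (ball z r) p ^ (-α) := by
  -- Ratios of two geometric series: `q₁ < 1`, over dyadic distances to `p`, uses `α > 0`; `q₂ < 1`,
  -- over dyadic layers, uses `α < 1 / 2`.
  set q₁ : ℝ := 2 ^ (-α) with hq₁
  set q₂ : ℝ := 2 ^ (α - 1 / 2) with hq₂
  have hq₁' : q₁ < 1 := Real.rpow_lt_one_of_one_lt_of_neg (by norm_num) (by linarith)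
  have hq₂' : q₂ < 1 := Real.rpow_lt_one_of_one_lt_of_neg (by norm_num) (by linarith)
  have hq₁0 : 0 < q₁ := by positivity
  have hq₂0 : 0 < q₂ := by positivity
  set T : ℝ≥0∞ := ENNReal.ofReal (2 * K * 2 ^ α) *
    ((1 - ENNReal.ofReal q₁)⁻¹ * (1 - ENNReal.ofReal q₂)⁻¹) with hT
  have hTtop : T ≠ ∞ := by
    refine ENNReal.mul_ne_top ENNReal.ofReal_ne_top (ENNReal.mul_ne_top ?_ ?_) <;>
    · rw [ENNReal.inv_ne_top]
      refine (tsub_pos_of_lt ?_).ne'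
      rw [← ENNReal.ofReal_one, ENNReal.ofReal_lt_ofReal_iff one_pos]
      assumption
  refine ⟨T.toNNReal, fun z r p S hS hp hx => ?_⟩
  rw [ENNReal.coe_toNNReal hTtop]
  set D := sideDist (ball z r) with hD
  rcases S.eq_empty_or_nonempty with rfl | ⟨x₀, hx₀⟩
  · simp
  have hptop : D p ≠ ∞ := ((hx x₀ hx₀).2.2.trans_lt (edist_lt_top _ _)).ne
  obtain ⟨δ, hδ0, hδ⟩ : ∃ δ : ℝ, 0 < δ ∧ D p = ENNReal.ofReal δ :=
    ⟨(D p).toReal, ENNReal.toReal_pos hp hptop, (ENNReal.ofReal_toReal hptop).symm⟩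
  set ρ : ℕ → ℝ := fun j => 2 ^ j * δ with hρ
  have hρ0 : ∀ j, 0 < ρ j := fun j => by positivity
  set c : ℕ × ℕ → ℝ := fun n => (ρ n.1)⁻¹ * (ρ n.1 / 2 ^ (n.2 + 1)) ^ (-α) with hc
  -- `E (j, i)` contains the points of `S` whose distance `t` to `p` is about `2 ^ j * δ` and whose
  -- side distance is about `t / 2 ^ i`; at those points `c (j, i)` dominates the integrand. Such a
  -- `j` exists because `δ ≤ t`, and such an `i` because the side distance is at most `t`.
  set E : ℕ × ℕ → Set X := fun n =>
    layer (ball z r) (2 * ρ n.1 / 2 ^ n.2) ∩ ball p (2 * ρ n.1) with hE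
  have hEm : ∀ n, MeasurableSet (E n) := fun n => by
    refine MeasurableSet.inter ?_ measurableSet_ball
    rw [layer_eq_sideDist_le]
    exact measurable_sideDist _ measurableSet_Iic
  have hpt : ∀ x ∈ S, (edist x p)⁻¹ * D x ^ (-α) ≤
      ∑' n, (E n).indicator (fun _ => ENNReal.ofReal (c n)) x := by
    intro x hxS
    obtain ⟨hx1, hx2, hx3⟩ := hx x hxS
    have hxtop : D x ≠ ∞ := (hx2.trans_lt (edist_lt_top _ _)).ne
    obtain ⟨d, hd0, hd⟩ : ∃ d : ℝ, 0 < d ∧ D x = ENNReal.ofReal d :=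
      ⟨(D x).toReal, ENNReal.toReal_pos hx1 hxtop, (ENNReal.ofReal_toReal hxtop).symm⟩
    set t := dist x p with ht
    rw [hd, edist_dist, ENNReal.ofReal_le_ofReal_iff dist_nonneg] at hx2
    rw [hδ, edist_dist, ENNReal.ofReal_le_ofReal_iff dist_nonneg] at hx3
    have ht0 : 0 < t := hδ0.trans_le hx3
    obtain ⟨j, hj1, hj2⟩ := exists_nat_pow_near ((one_le_div hδ0).mpr hx3)
      (by norm_num : (1 : ℝ) < 2)
    obtain ⟨i, hi1, hi2⟩ := exists_nat_pow_near ((one_le_div hd0).mpr hx2)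
      (by norm_num : (1 : ℝ) < 2)
    rw [le_div_iff₀ hδ0] at hj1
    rw [div_lt_iff₀ hδ0, pow_succ] at hj2
    rw [le_div_iff₀ hd0] at hi1
    rw [div_lt_iff₀ hd0] at hi2
    have hi : (0 : ℝ) < 2 ^ i := by positivity
    have hmem : x ∈ E (j, i) := by
      refine ⟨?_, ?_⟩
      · rw [layer_eq_sideDist_le, mem_ofPred_eq, ← hD, hd]
        refine ENNReal.ofReal_le_ofReal ?_
        rw [le_div_iff₀ hi]
        simp only [hρ]
        linarith
      · rw [mem_ball]
        simp only [hρ]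
        linarith
    refine le_trans ?_ (ENNReal.le_tsum (j, i))
    rw [indicator_of_mem hmem, edist_dist, ← ENNReal.ofReal_inv_of_pos ht0, hd,
      ENNReal.ofReal_rpow_of_pos hd0, ← ENNReal.ofReal_mul (by positivity)]
    refine ENNReal.ofReal_le_ofReal ?_
    simp only [hc]
    have h1 : t⁻¹ ≤ (ρ j)⁻¹ := inv_anti₀ (hρ0 j) hj1
    have h2 : d ^ (-α) ≤ (ρ j / 2 ^ (i + 1)) ^ (-α) := by
      refine Real.rpow_le_rpow_of_nonpos (by positivity) ?_ (by linarith)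
      rw [div_le_iff₀ (by positivity)]
      simp only [hρ]
      linarith
    exact mul_le_mul h1 h2 (by positivity) (inv_nonneg.mpr (hρ0 j).le)
  have hterm : ∀ n : ℕ × ℕ, ENNReal.ofReal (c n) * μ (E n) ≤
      ENNReal.ofReal (2 * K * 2 ^ α) * D p ^ (-α) *
        (ENNReal.ofReal q₁ ^ n.1 * ENNReal.ofReal q₂ ^ n.2) := by
    rintro ⟨j, i⟩
    have hi : (0 : ℝ) < 2 ^ i := by positivity
    have hc0 : 0 ≤ c (j, i) := by have := hρ0 j; positivity
    -- Layer decay bounds the measure by `2 K ρ_j 2 ^ (-i / 2)`. The factor `ρ_j` cancels the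
    -- kernel, leaving `δ ^ (-α) q₁ ^ j q₂ ^ i` up to a constant.
    have hμ := h z r p (2 * ρ j) (2 * ρ j / 2 ^ i) (by linarith [hρ0 j])
      (div_pos (by linarith [hρ0 j]) hi)
    calc ENNReal.ofReal (c (j, i)) * μ (E (j, i))
        ≤ ENNReal.ofReal (c (j, i)) *
            ENNReal.ofReal (K * √(2 * ρ j / 2 ^ i * (2 * ρ j))) := by gcongr
      _ = ENNReal.ofReal (2 * K * 2 ^ α * δ ^ (-α) * (q₁ ^ j * q₂ ^ i)) := by
          rw [← ENNReal.ofReal_mul hc0]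
          congr 1
          have h1 : √(2 * ρ j / 2 ^ i * (2 * ρ j)) = 2 * ρ j * (2 ^ i : ℝ) ^ (-(1 / 2) : ℝ) := by
            have : 2 * ρ j / 2 ^ i * (2 * ρ j) = (2 * ρ j) ^ 2 * (2 ^ i : ℝ)⁻¹ := by ring
            rw [this, Real.sqrt_mul (sq_nonneg _), Real.sqrt_sq (by linarith [hρ0 j]),
              Real.rpow_neg hi.le, ← Real.sqrt_eq_rpow, Real.sqrt_inv]
          have h2 : (ρ j / 2 ^ (i + 1)) ^ (-α) =
              q₁ ^ j * δ ^ (-α) * ((2 ^ i : ℝ) ^ α * 2 ^ α) := by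
            simp only [hρ]
            rw [Real.div_rpow (by positivity) (by positivity),
              Real.mul_rpow (by positivity) hδ0.le, Real.rpow_neg (by positivity) α (x := 2 ^ (i + 1)),
              div_inv_eq_mul, pow_succ, Real.mul_rpow hi.le (by norm_num), hq₁,
              Real.rpow_pow_comm (by norm_num)]
          have h3 : q₂ ^ i = (2 ^ i : ℝ) ^ α * (2 ^ i : ℝ) ^ (-(1 / 2) : ℝ) := by
            rw [← Real.rpow_add hi, ← sub_eq_add_neg, hq₂, Real.rpow_pow_comm (by norm_num)]
          have h4 := (hρ0 j).ne'
          simp only [hc]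
          rw [h1, h2, h3]
          field_simp
      _ = _ := by
          rw [hδ, ENNReal.ofReal_rpow_of_pos hδ0,
            ENNReal.ofReal_mul (p := 2 * K * 2 ^ α * δ ^ (-α)) (by positivity),
            ENNReal.ofReal_mul (p := 2 * K * 2 ^ α) (by positivity),
            ENNReal.ofReal_mul (p := q₁ ^ j) (by positivity),
            ENNReal.ofReal_pow hq₁0.le, ENNReal.ofReal_pow hq₂0.le]
  calc ∫⁻ x in S, (edist x p)⁻¹ * D x ^ (-α) ∂μ
      ≤ ∫⁻ x in S, ∑' n, (E n).indicator (fun _ => ENNReal.ofReal (c n)) x ∂μ :=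
        setLIntegral_mono' hS hpt
    _ ≤ ∫⁻ x, ∑' n, (E n).indicator (fun _ => ENNReal.ofReal (c n)) x ∂μ :=
        setLIntegral_le_lintegral _ _
    _ = ∑' n, ENNReal.ofReal (c n) * μ (E n) := by
        rw [lintegral_tsum fun n => (measurable_const.indicator (hEm n)).aemeasurable]
        exact tsum_congr fun n => lintegral_indicator_const (hEm n) _
    _ ≤ ∑' n : ℕ × ℕ, ENNReal.ofReal (2 * K * 2 ^ α) * D p ^ (-α) *
          (ENNReal.ofReal q₁ ^ n.1 * ENNReal.ofReal q₂ ^ n.2) := ENNReal.tsum_le_tsum hterm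
    _ = T * D p ^ (-α) := by
        rw [ENNReal.tsum_mul_left, ENNReal.tsum_prod (f := fun j i : ℕ =>
          ENNReal.ofReal q₁ ^ j * ENNReal.ofReal q₂ ^ i)]
        simp_rw [ENNReal.tsum_mul_left, ENNReal.tsum_mul_right, ENNReal.tsum_geometric]
        rw [hT]
        ring

/-- If balls have measure at least their radius and layers decay, the Hardy property holds. -/
theorem SqrtLayerDecay.hardyProperty [SecondCountableTopology X] [SFinite μ] {K : ℝ} (hK : 0 ≤ K)
    (h : SqrtLayerDecay μ K) (hlow : ∀ (x : X) (r : ℝ), ENNReal.ofReal r ≤ μ (ball x r)) :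
    HardyProperty μ := by
  intro p hp
  have hpq : p.HolderConjugate (p / (p - 1)) := Real.HolderConjugate.conjExponent hp
  set q := p / (p - 1) with hq
  have hp0 := hpq.pos
  have hq0 := hpq.symm.pos
  have hp1 : 1 / p < 1 := by rw [div_lt_one hp0]; exact hpq.lt
  have hq1 : 1 / q < 1 := by rw [div_lt_one hq0]; exact hpq.symm.lt
  -- This choice gives `β p = 1 / (2 q)` and `β q = 1 / (2 p)`, both in the admissible range `(0, 1
  -- / 2)`.
  set β : ℝ := 1 / (2 * p * q) with hβ
  have hβ0 : 0 < β := by positivity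
  have hβp : β * p = 1 / q / 2 := by rw [hβ]; field_simp
  have hβq : β * q = 1 / p / 2 := by rw [hβ]; field_simp
  obtain ⟨C₁, hC₁⟩ := h.exists_lintegral_le hK (α := β * p) (by positivity) (by rw [hβp]; linarith)
  obtain ⟨C₂, hC₂⟩ := h.exists_lintegral_le hK (α := β * q) (by positivity) (by rw [hβq]; linarith)
  refine ⟨max C₁ C₂, fun z r hr f g hf _ hg _ => ?_⟩
  set B := ball z r with hB
  set A := ball z (2 * r) \ B with hA
  -- A point of `A` shows that the complement of `B` is nonempty, so the weight is finite.
  rcases A.eq_empty_or_nonempty with hAe | ⟨x₀, hx₀⟩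
  · simp [hAe]
  have hBm : MeasurableSet B := measurableSet_ball
  have hAm : MeasurableSet A := measurableSet_ball.diff hBm
  set D := sideDist B with hD
  have hDm : Measurable D := measurable_sideDist B
  have hDtop : ∀ x, D x ≠ ∞ := fun x => by
    by_cases hx : x ∈ B
    · exact ((sideDist_le_edist_of_mem hx hx₀.2).trans_lt (edist_lt_top _ _)).ne
    · exact ((sideDist_le_edist_of_notMem hx (mem_ball_self hr)).trans_lt (edist_lt_top _ _)).ne
  have hDae : {x | D x ≠ 0} =ᵐ[μ] (univ : Set X) :=
    Filter.eventuallyEq_univ.mpr (h.ae_sideDist_ne_zero z r)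
  have hres : ∀ S : Set X, μ.restrict S = μ.restrict (S ∩ {x | D x ≠ 0}) := fun S => by
    refine Measure.restrict_congr_set ?_
    have := (Filter.EventuallyEq.refl _ S).inter hDae
    rw [inter_univ] at this
    exact this.symm
  have hD0m : MeasurableSet {x | D x ≠ 0} := (hDm (measurableSet_singleton 0)).compl
  have hBm' := hBm.inter hD0m
  have hAm' := hAm.inter hD0m
  have hDrpow : ∀ (x : X) (s : ℝ), (D x ^ β) ^ (-s) = D x ^ (-(β * s)) := fun x s => by
    rw [← ENNReal.rpow_mul, mul_neg]
  have hweight : ∀ x, D x ≠ 0 → D x ^ β ≠ 0 ∧ D x ^ β ≠ ∞ := fun x hx =>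
    ⟨by simp [ENNReal.rpow_eq_zero_iff, hx, hβ0.not_gt], ENNReal.rpow_ne_top_of_nonneg hβ0.le (hDtop x)⟩
  have hnorm : ∀ (S : Set X) (u : X → ℂ) (s : ℝ), 0 < s →
      (∫⁻ x in S, ‖u x‖ₑ ^ s ∂μ) ^ (1 / s) ≤ eLpNorm u (ENNReal.ofReal s) μ := fun S u s hs => by
    rw [eLpNorm_eq_lintegral_rpow_enorm_toReal (by simpa using hs) ENNReal.ofReal_ne_top,
      ENNReal.toReal_ofReal hs.le]
    exact ENNReal.rpow_le_rpow (setLIntegral_le_lintegral _ _) (by positivity)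
  calc ∫⁻ y in B, ∫⁻ x in A, ‖f y * g x‖ₑ / μ (ball x (dist x y)) ∂μ ∂μ
      ≤ ∫⁻ y in B, ∫⁻ x in A, ‖f y‖ₑ * ‖g x‖ₑ * (edist x y)⁻¹ ∂μ ∂μ := by
        refine lintegral_mono fun y => lintegral_mono fun x => ?_
        rw [enorm_mul, div_eq_mul_inv, edist_dist]
        gcongr
        exact hlow _ _
    _ = ∫⁻ y in B ∩ {x | D x ≠ 0}, ∫⁻ x in A ∩ {x | D x ≠ 0},
          ‖f y‖ₑ * ‖g x‖ₑ * (edist x y)⁻¹ ∂μ ∂μ := by rw [← hres A, ← hres B]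
    _ ≤ (max C₁ C₂ : ℝ≥0) * (∫⁻ y in B ∩ {x | D x ≠ 0}, ‖f y‖ₑ ^ p ∂μ) ^ (1 / p) *
          (∫⁻ x in A ∩ {x | D x ≠ 0}, ‖g x‖ₑ ^ q ∂μ) ^ (1 / q) := by
        refine lintegral_lintegral_le_of_schur hpq (k := fun y x => (edist x y)⁻¹)
          (a := fun y => D y ^ β) (b := fun x => D x ^ β) ?_ (hDm.pow_const β) (hDm.pow_const β)
          (ae_restrict_of_forall_mem hBm' fun y hy => hweight y hy.2)
          (ae_restrict_of_forall_mem hAm' fun x hx => hweight x hx.2)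
          (ae_restrict_of_forall_mem hBm' fun y hy => ?_)
          (ae_restrict_of_forall_mem hAm' fun x hx => ?_)
          hf.1.enorm.restrict hg.1.enorm.restrict
        · exact (measurable_edist.comp measurable_swap).inv
        · simp only [hDrpow]
          refine (hC₁ z r y _ hAm' hy.2 fun x hx => ⟨hx.2,
            sideDist_le_edist_of_notMem hx.1.2 hy.1, ?_⟩).trans ?_
          · rw [edist_comm]; exact sideDist_le_edist_of_mem hy.1 hx.1.2
          · gcongr; exact le_max_left _ _
        · simp only [hDrpow, edist_comm x]
          refine (hC₂ z r x _ hBm' hx.2 fun y hy => ⟨hy.2,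
            sideDist_le_edist_of_mem hy.1 hx.1.2, ?_⟩).trans ?_
          · rw [edist_comm]; exact sideDist_le_edist_of_notMem hx.1.2 hy.1
          · gcongr; exact le_max_right _ _
    _ ≤ _ := by
        gcongr
        · exact hnorm _ f p hp0
        · exact hnorm _ g q hq0

end LayerDecay

theorem hardyProperty_tesseraCurve : HardyProperty (μH[1] : Measure tesseraCurve) := by
  -- Supplies the s-finiteness that Tonelli's theorem needs.
  have : IsLocallyFiniteMeasure (μH[1] : Measure tesseraCurve) :=
    ⟨fun x => ⟨ball x 1, ball_mem_nhds x one_pos,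
      (hausdorffMeasure_ball_le x one_pos).trans_lt ENNReal.ofReal_lt_top⟩⟩
  exact SqrtLayerDecay.hardyProperty (K := 10080) (by norm_num)
    (fun z r w _ _ hR hε => hausdorffMeasure_layer_inter_ball_le z r w hR hε)
    ofReal_le_hausdorffMeasure_ball

/-! ### Properties that fail -/

lemma ofReal_mem_tesseraSegment_zero {a : ℝ} (h0 : 0 ≤ a) (h1 : a ≤ 1) :
    (a : ℂ) ∈ tesseraSegment 0 := ⟨a, by simp [tesseraInner, h0, h1], by simp⟩

lemma zero_mem_tesseraCurve : (0 : ℂ) ∈ tesseraCurve := by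
  simpa using tesseraSegment_subset 0 (ofReal_mem_tesseraSegment_zero le_rfl zero_le_one)

lemma I_mem_tesseraArc_zero : Complex.I ∈ tesseraArc 0 := ⟨by simp, by simp⟩

/-- Points of the curve close to `i` have modulus `1`. -/
lemma norm_eq_one_of_norm_sub_I_lt {x : ℂ} (hx : x ∈ tesseraCurve) (h : ‖x - Complex.I‖ < 1 / 2) :
    ‖x‖ = 1 := by
  have h1 := norm_sub_norm_le x Complex.I
  have h2 := norm_sub_norm_le Complex.I x
  rw [norm_sub_rev] at h2
  rw [Complex.norm_I] at h1 h2
  by_contra hne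
  have him : x.im = 0 := by
    refine im_eq_zero_of_mem_tesseraCurve hx fun k hk => ?_
    rcases k with _ | k
    · exact hne (by simpa using hk)
    · have : (1 : ℝ) ≤ 2 ^ k := one_le_pow₀ (by norm_num)
      rw [pow_succ] at hk
      linarith
  have h3 := Complex.abs_im_le_norm (x - Complex.I)
  rw [Complex.sub_im, him, Complex.I_im] at h3
  norm_num at h3
  linarith

/-- The ball of radius `1 / 2` about `i` lies on the unit circle, hence in arbitrarily thin annuli
about `0`, and has length at least `1 / 2`. -/
theorem not_annularDecay_tesseraCurve : ¬ AnnularDecay (μH[1] : Measure tesseraCurve) := by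
  rintro ⟨η, hη, C, h⟩
  have hlim : Filter.Tendsto (fun δ : ℝ => (C : ℝ) * (2 * δ) ^ η * 560)
      (nhdsWithin 0 (Ioi 0)) (nhds 0) := by
    have : Continuous fun δ : ℝ => (C : ℝ) * (2 * δ) ^ η * 560 := by
      have := Real.continuous_rpow_const (q := η) hη.le
      fun_prop
    simpa [Real.zero_rpow hη.ne'] using (this.tendsto 0).mono_left nhdsWithin_le_nhds
  have hev := hlim.eventually (gt_mem_nhds (by norm_num : (0 : ℝ) < 1 / 2))
  have hev' : ∀ᶠ δ : ℝ in nhdsWithin 0 (Ioi 0), δ < 1 / 2 :=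
    nhdsWithin_le_nhds (gt_mem_nhds (by norm_num))
  obtain ⟨δ, hδ, hδ', hδ0 : 0 < δ⟩ := (hev.and (hev'.and self_mem_nhdsWithin)).exists
  have h1 := h ⟨0, zero_mem_tesseraCurve⟩ (1 + δ) (2 * δ) (by linarith) (by linarith) (by linarith)
  have hsub : ball (⟨Complex.I, tesseraArc_subset 0 I_mem_tesseraArc_zero⟩ : tesseraCurve) (1 / 2) ⊆
      annulus ⟨0, zero_mem_tesseraCurve⟩ (1 + δ) (1 + δ - 2 * δ) := by
    intro x hx
    rw [mem_ball, Subtype.dist_eq, dist_eq_norm] at hx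
    have hx1 := norm_eq_one_of_norm_sub_I_lt x.2 hx
    simp only [annulus, mem_sdiff, mem_ball, Subtype.dist_eq, dist_zero_right, hx1]
    constructor <;> linarith
  have h2 := (ofReal_le_hausdorffMeasure_ball _ _).trans ((measure_mono hsub).trans h1)
  have h3 : ENNReal.ofReal (1 / 2) ≤ ENNReal.ofReal ((C : ℝ) * (2 * δ) ^ η * 560) := by
    refine h2.trans ?_
    rw [ENNReal.ofReal_mul (by positivity), ENNReal.ofReal_mul (by positivity),
      ENNReal.ofReal_coe_nnreal]
    gcongr
    · exact div_le_self (by linarith) (by linarith)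
    · refine (hausdorffMeasure_ball_le _ (by linarith)).trans (ENNReal.ofReal_le_ofReal (by linarith))
  rw [ENNReal.ofReal_le_ofReal_iff (by positivity)] at h3
  linarith

theorem RelativeAnnularDecay.annularDecay {X : Type*} [MetricSpace X] [MeasurableSpace X]
    {μ : Measure X} (h : RelativeAnnularDecay μ) : AnnularDecay μ := by
  obtain ⟨η, hη, C, h⟩ := h
  refine ⟨η, hη, C, fun z r s hr hs hsr => ?_⟩
  have := h z r s hr hs hsr z r hr (by linarith)
  rwa [annulus, inter_eq_left.mpr sdiff_subset] at this

theorem not_monotoneGeodesic_tesseraCurve : ¬ MonotoneGeodesic tesseraCurve := by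
  rintro ⟨C, hC, h⟩
  -- Small enough that `C u < 1 / 2`: the intermediate point then has modulus `1` and is no closer
  -- to `0` than `i` is.
  set u : ℝ := min 1 (1 / (4 * C)) with hu
  have hu0 : 0 < u := by positivity
  have huC : C * u ≤ 1 / 4 := by
    calc C * u ≤ C * (1 / (4 * C)) := by gcongr; exact min_le_right _ _
      _ = 1 / 4 := by field_simp
  obtain ⟨z, hz1, hz2⟩ := h u hu0 ⟨0, zero_mem_tesseraCurve⟩
    ⟨Complex.I, tesseraArc_subset 0 I_mem_tesseraArc_zero⟩ (by
      rw [Subtype.dist_eq, dist_zero_left, Complex.norm_I]; exact min_le_left _ _)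
  rw [Subtype.dist_eq, dist_eq_norm] at hz1
  simp only [Subtype.dist_eq, dist_zero_right, Complex.norm_I] at hz2
  rw [norm_eq_one_of_norm_sub_I_lt z.2 (by linarith)] at hz2
  linarith

/-- Near the point `2`, a ball centred at `t ^ 2` whose radius barely exceeds `2 - t ^ 2` contains
only points at distance at most a multiple of `t` from `2`. -/
lemma norm_sub_two_lt {x : ℂ} (hx : x ∈ tesseraCurve) {t : ℝ} (ht0 : 0 < t) (ht1 : t < 1 / 2)
    (h1 : ‖x - 2‖ < 1) (h2 : ‖x - (t ^ 2 : ℝ)‖ < 2 - t ^ 2 + t ^ 4) : ‖x - 2‖ < 3 * t := by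
  have hre := (abs_lt.mp ((Complex.abs_re_le_norm (x - 2)).trans_lt h1)).1
  rw [Complex.sub_re, Complex.re_ofNat] at hre
  have hn1 := Complex.re_le_norm x
  have hn2 := norm_sub_norm_le x 2
  rw [Complex.norm_two] at hn2
  by_cases hk : ∃ k : ℕ, ‖x‖ = 2 ^ k
  · obtain ⟨k, hk⟩ := hk
    have hx2 : ‖x‖ = 2 := by
      rcases k with _ | _ | k
      · rw [pow_zero] at hk; linarith
      · simpa using hk
      · have : (1 : ℝ) ≤ 2 ^ k := one_le_pow₀ (by norm_num)
        rw [pow_succ, pow_succ] at hk; linarith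
    have e1 : x.re * x.re + x.im * x.im = 4 := by
      rw [← Complex.normSq_apply, ← Complex.sq_norm, hx2]; norm_num
    have e2 := pow_lt_pow_left₀ h2 (norm_nonneg _) two_ne_zero
    rw [Complex.sq_norm, Complex.normSq_apply, Complex.sub_re, Complex.sub_im, Complex.ofReal_re,
      Complex.ofReal_im] at e2
    refine lt_of_pow_lt_pow_left₀ 2 (by positivity) ?_
    rw [Complex.sq_norm, Complex.normSq_apply, Complex.sub_re, Complex.sub_im, Complex.re_ofNat,
      Complex.im_ofNat]
    have ht2 : 0 < t ^ 2 := by positivity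
    have ht4 : t ^ 2 < 1 := by nlinarith
    -- On the circle of radius `2`, expanding the ball condition gives `2 x.re > 4 - 4 t ^ 2`, hence
    -- `‖x - 2‖ ^ 2 = 8 - 4 x.re < 8 t ^ 2`.
    have e3 : t ^ 2 * (4 - 4 * t ^ 2) < t ^ 2 * (2 * x.re) := by
      nlinarith [mul_pos ht2 ht2, mul_pos (mul_pos ht2 ht2) ht2,
        mul_pos (mul_pos ht2 ht2) (sub_pos.mpr ht4),
        mul_pos (mul_pos (mul_pos ht2 ht2) ht2) (sub_pos.mpr ht4)]
    have e4 := lt_of_mul_lt_mul_left e3 ht2.le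
    nlinarith
  · push Not at hk
    have him := im_eq_zero_of_mem_tesseraCurve hx hk
    have hxe : ((x.re : ℝ) : ℂ) = x := Complex.ext rfl him.symm
    have hxn : ‖x‖ = x.re := by
      rw [← hxe, Complex.norm_real, Complex.ofReal_re, Real.norm_eq_abs, abs_of_pos (by linarith)]
    -- The segment with moduli in `[1, 2]` is on the negative axis, so real points of the curve near
    -- `2` and different from it lie to its right.
    have h2x : 2 < x.re := by
      by_contra hle
      have hlt : ‖x‖ < 2 ^ 1 := lt_of_le_of_ne (by rw [hxn]; linarith) (hk 1)
      have hs := (norm_of_mem_tesseraSegment (mem_tesseraSegment_of_norm (k := 1) hx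
        (by rw [hxn]; simp only [tesseraInner]; linarith) hlt)).2.2
      rw [pow_one, neg_one_mul] at hs
      have := congrArg Complex.re hs
      rw [Complex.neg_re, Complex.ofReal_re] at this
      linarith [norm_nonneg x]
    have h3 := (abs_lt.mp ((Complex.abs_re_le_norm _).trans_lt h2)).2
    rw [Complex.sub_re, Complex.ofReal_re] at h3
    rw [← hxe, show (2 : ℂ) = ((2 : ℝ) : ℂ) by simp, ← Complex.ofReal_sub, Complex.norm_real,
      Real.norm_eq_abs, abs_of_pos (by linarith)]
    have : t ^ 4 < t := by
      have := pow_lt_pow_right_of_lt_one₀ ht0 (by linarith) (by norm_num : 1 < 4)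
      simpa using this
    linarith

/-- The trace on the ball of `B(2, 1)` has length `O(t)`, while that of `B(2, 2)` contains the ball
of radius `1 / 2` about the point `1 / 2`. -/
theorem not_homogeneousBalls_tesseraCurve :
    ¬ HomogeneousBalls (μH[1] : Measure tesseraCurve) := by
  rintro ⟨C, h⟩
  -- Chosen so that `C * 280 * 3 t < 1 / 2` and `t < 1 / 2`.
  set t : ℝ := 1 / (4 + 2000 * C) with ht
  have hC : (0 : ℝ) ≤ C := C.2
  have ht0 : 0 < t := by positivity
  have htC : t * (4 + 2000 * C) = 1 := by rw [ht]; field_simp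
  have ht1 : t < 1 / 2 := by nlinarith
  have hsq : t ^ 2 < 1 / 4 := by nlinarith
  have ht4 : 0 < t ^ 4 := by positivity
  set z : tesseraCurve := ⟨(t ^ 2 : ℝ), tesseraSegment_subset 0
    (ofReal_mem_tesseraSegment_zero (sq_nonneg t) (by linarith))⟩ with hz
  set w : tesseraCurve := ⟨2, tesseraArc_subset 1
    (mem_tesseraArc_of_im_eq_zero (by simp) (by simp))⟩ with hw
  set v : tesseraCurve := ⟨(1 / 2 : ℝ), tesseraSegment_subset 0
    (ofReal_mem_tesseraSegment_zero (by norm_num) (by norm_num))⟩ with hv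
  have hwz : dist w z = 2 - t ^ 2 := by
    rw [Subtype.dist_eq, dist_eq_norm, show (w : ℂ) = ((2 : ℝ) : ℂ) by simp [hw],
      ← Complex.ofReal_sub, Complex.norm_real, Real.norm_eq_abs, abs_of_pos (by linarith)]
  have hvw : dist v w = 3 / 2 := by
    rw [Subtype.dist_eq, dist_eq_norm, show (w : ℂ) = ((2 : ℝ) : ℂ) by simp [hw],
      ← Complex.ofReal_sub, Complex.norm_real]
    norm_num
  have hvz : dist v z = 1 / 2 - t ^ 2 := by
    rw [Subtype.dist_eq, dist_eq_norm, ← Complex.ofReal_sub, Complex.norm_real, Real.norm_eq_abs,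
      abs_of_pos (by linarith)]
  have h1 := (h z (2 - t ^ 2 + t ^ 4) (by linarith)).1 w (by rw [mem_ball, hwz]; linarith) 1 one_pos
  have hsub1 : ball v (1 / 2) ⊆ ball w (2 * 1) ∩ ball z (2 - t ^ 2 + t ^ 4) := by
    intro x hx
    rw [mem_ball] at hx
    constructor
    · rw [mem_ball]; linarith [dist_triangle x v w]
    · rw [mem_ball]; linarith [dist_triangle x v z]
  have hsub2 : ball w 1 ∩ ball z (2 - t ^ 2 + t ^ 4) ⊆ ball w (3 * t) := by
    rintro x ⟨hx1, hx2⟩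
    rw [mem_ball, Subtype.dist_eq, dist_eq_norm] at *
    exact norm_sub_two_lt x.2 ht0 ht1 hx1 hx2
  have h2 : ENNReal.ofReal (1 / 2) ≤ ENNReal.ofReal (C * (280 * (3 * t))) := by
    rw [ENNReal.ofReal_mul hC, ENNReal.ofReal_coe_nnreal]
    refine (ofReal_le_hausdorffMeasure_ball v _).trans <| (measure_mono hsub1).trans <| h1.trans ?_
    gcongr
    exact (measure_mono hsub2).trans (hausdorffMeasure_ball_le w (by positivity))
  rw [ENNReal.ofReal_le_ofReal_iff (by positivity)] at h2
  nlinarith [mul_nonneg hC ht0.le]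

theorem mainTheorem4 :
    IsAhlforsDavidRegularOne (μH[1] : Measure tesseraCurve) ∧
    IsHomogeneousType (μH[1] : Measure tesseraCurve) ∧
    ¬ AnnularDecay (μH[1] : Measure tesseraCurve) ∧
    ¬ RelativeAnnularDecay (μH[1] : Measure tesseraCurve) ∧
    ¬ HomogeneousBalls (μH[1] : Measure tesseraCurve) ∧
    ¬ MonotoneGeodesic tesseraCurve ∧
    RelativeLayerDecay (μH[1] : Measure tesseraCurve) ∧
    HardyProperty (μH[1] : Measure tesseraCurve) :=
  ⟨isAhlforsDavidRegularOne_tesseraCurve, isHomogeneousType_tesseraCurve,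
    not_annularDecay_tesseraCurve, fun h => not_annularDecay_tesseraCurve h.annularDecay,
    not_homogeneousBalls_tesseraCurve, not_monotoneGeodesic_tesseraCurve,
    relativeLayerDecay_tesseraCurve, hardyProperty_tesseraCurve⟩
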